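/- Let $(R,\mathfrak m,K)$ be either a Noetherian local ring with maximal ideal $\mathfrak m$ and residue field $K$, or a standard graded Noetherian $K$-algebra over a field $K$ (that is, $R=\bigoplus_{k\ge0}R_k$ with $R_0=K$, generated as a $K$-algebra by the finite-dimensional space $R_1$) with homogeneous maximal ideal $\mathfrak m=\bigoplus_{k>0}R_k$. Assume that $K$ is infinite, that $\operatorname{depth}R>0$ (depth being the supremum of the lengths of $R$-regular sequences in $\mathfrak m$), and that $R$ is regular. Let $I\subseteq R$ be an ideal, assumed homogeneous in the graded case. An ideal $J$ is called *$\mathfrak m$-full* if $(J\mathfrak m:x)=J$ for a generic $x\in\mathfrak m\setminus\mathfrak m^2$, *full* if $(J:x)=(J:\mathfrak m)$ for a generic $x\in\mathfrak m\setminus\mathfrak m^2$, and *weakly $\mathfrak m$-full* if $(J\mathfrak m:\mathfrak m)=J$. Here "for a generic $x$" means: for all $x\in\mathfrak m\setminus\mathfrak m^2$ whose class lies in some non-empty Zariski open subset of the affine space $\mathfrak m/\mathfrak m^2$ over $R/\mathfrak m$. Let $\mathfrak d_1(I)$, $\mathfrak d_2(I)$, $\mathfrak d_3(I)$ be the smallest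 $\ell\ge0$ such that $I\mathfrak m^k$ is, respectively, $\mathfrak m$-full, full, weakly $\mathfrak m$-full for all $k\ge\ell$. Let $\mathcal R(\mathfrak m)=\bigoplus_{k\ge0}\mathfrak m^k$ be the Rees algebra of $\mathfrak m$, and let $\mathcal R(\mathfrak m,I)=\bigoplus_{k\ge0}I\mathfrak m^k$ be the extension of $I$ to it. For a nonzero finitely generated graded module $M$ over $\mathcal R(\mathfrak m)$ put $$\operatorname{reg}_{\mathcal R(\mathfrak m)}M=\max\{\,j-i : H_i(\mathbf y;M)_j\neq0\,\},$$ where $\mathbf y$ is any minimal homogeneous system of generators of the ideal $\bigoplus_{k>0}\mathfrak m^k$ of $\mathcal R(\mathfrak m)$ and $H_i(\mathbf y;M)$ is Koszul homology. Then the three minima $\mathfrak d_1(I),\mathfrak d_2(I),\mathfrak d_3(I)$ exist, and $$\mathfrak d_2(I)\le\mathfrak d_3(I)=\mathfrak d_1(I);$$ if moreover $I\ne0$, then, for every such $\mathbf y$, the maximum defining $\operatorname{reg}_{\mathcal R(\mathfrak m)}\mathcal R(\mathfrak m,I)$ exists and $$\mathfrak d_1(I)\le\operatorname{reg}_{\mathcal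 R(\mathfrak m)}\mathcal R(\mathfrak m,I).$$ -/

import Mathlib

/-! ### Depth -/

/-- The depth (grade) of the ideal `m` on the ring `R`: the supremum of the lengths of the
`R`-regular sequences contained in `m`. For a Noetherian local ring, or a standard graded algebra
over a field, with (homogeneous) maximal ideal `m`, this is `depth R`. -/
noncomputable def ringDepth {R : Type*} [CommRing R] (m : Ideal R) : ℕ∞ :=
  ⨆ rs ∈ {rs : List R | (∀ r ∈ rs, r ∈ m) ∧ RingTheory.Sequence.IsRegular R rs}, (rs.length : ℕ∞)

/-! ### Generic elements of `m ∖ m²` -/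

/-- The polynomial functions on a `k`-module `V`: the algebra of functions generated by the linear
forms (for `V = kⁿ` these are the functions given by polynomials in the `n` coordinates). -/
def polyFunctions (k V : Type*) [CommRing k] [AddCommGroup V] [Module k V] :
    Subalgebra k (V → k) :=
  Algebra.adjoin k {f | ∃ φ : Module.Dual k V, f = ⇑φ}

/-- Zariski open sets of (the affine space) `V`: the sets of points at which not all members of
some family of polynomial functions vanish. -/
def IsZariskiOpen (k : Type*) {V : Type*} [CommRing k] [AddCommGroup V] [Module k V]
    (U : Set V) : Prop :=
  ∃ S : Set (V → k), S ⊆ polyFunctions k V ∧ U = {v | ∃ f ∈ S, f v ≠ 0}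

/-- `P x` holds for a generic `x ∈ m ∖ m²`: there is a nonempty Zariski open subset `U` of the
affine space `m / m²` over `R / m` such that `P x` holds for all `x ∈ m ∖ m²` whose class is
in `U`. -/
def ForGeneric {R : Type*} [CommRing R] (m : Ideal R) (P : R → Prop) : Prop :=
  ∃ U : Set m.Cotangent, IsZariskiOpen (R ⧸ m) U ∧ U.Nonempty ∧
    ∀ x : m, (x : R) ∉ m ^ 2 → m.toCotangent x ∈ U → P x

/-! ### Fullness and the Dao numbers -/

/-- `I` is `m`-full: `(I m : x) = I` for a generic element `x ∈ m ∖ m²`. -/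
def IsMFull {R : Type*} [CommRing R] (m I : Ideal R) : Prop :=
  ForGeneric m fun x => (I * m).colon {x} = I

/-- `I` is full: `(I : x) = (I : m)` for a generic element `x ∈ m ∖ m²`. -/
def IsFull {R : Type*} [CommRing R] (m I : Ideal R) : Prop :=
  ForGeneric m fun x => I.colon {x} = I.colon (m : Set R)

/-- `I` is weakly `m`-full: `(I m : m) = I`. -/
def IsWeaklyMFull {R : Type*} [CommRing R] (m I : Ideal R) : Prop :=
  (I * m).colon (m : Set R) = I

/-- `d` is the Dao number of `I` belonging to the property `P` (of pairs `(m, J)`): the minimum,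
which is required to exist, of all `ℓ` such that `I m ^ k` has the property `P` for all `k ≥ ℓ`. -/
def IsDaoNumber {R : Type*} [CommRing R] (P : Ideal R → Ideal R → Prop) (m I : Ideal R)
    (d : ℕ) : Prop :=
  IsLeast {ℓ : ℕ | ∀ k ≥ ℓ, P m (I * m ^ k)} d

/-! ### Koszul homology and Castelnuovo–Mumford regularity -/

section Koszul

variable {A M : Type*} [CommRing A] [AddCommGroup M] [Module A M]

/-- The differential of the Koszul complex `⋀ Aⁿ ⊗ M` of `y₁, …, yₙ` on `M`. An element
`∑_S e_S ⊗ c_S`, where `S` runs over the subsets of `{1, …, n}`, is represented by the family `c`,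
and `e_S ⊗ c` is mapped to `∑_{s ∈ S} (-1) ^ #{t ∈ S | t < s} e_{S ∖ s} ⊗ y_s c`. -/
def koszulD {n : ℕ} (y : Fin n → A) : (Finset (Fin n) → M) →ₗ[A] (Finset (Fin n) → M) where
  toFun c T := ∑ s ∈ Tᶜ, ((-1) ^ (T.filter (· < s)).card * y s) • c (insert s T)
  map_add' c c' := by
    funext T
    simp [smul_add, Finset.sum_add_distrib]
  map_smul' a c := by
    funext T
    simp only [Pi.smul_apply, Finset.smul_sum, RingHom.id_apply]
    exact Finset.sum_congr rfl fun s _ => smul_comm _ _ _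

/-- The component of degree `d : ℤ` of a module graded by `ℕ` (zero in negative degrees). -/
def gradedPart (ℳ : ℕ → AddSubgroup M) (d : ℤ) : AddSubgroup M :=
  if 0 ≤ d then ℳ d.toNat else ⊥

/-- The component `K_i(y; M)_j` of internal degree `j` of the `i`th module of the Koszul complex,
for `y₁, …, yₙ` of degree one: `e_S` has homological and internal degree `#S`, so the components
are combinations of the `e_S ⊗ c` with `#S = i` and `c ∈ M_{j-i}`. -/
def koszulChains (ℳ : ℕ → AddSubgroup M) (n i : ℕ) (j : ℤ) :
    AddSubgroup (Finset (Fin n) → M) :=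
  AddSubgroup.pi Set.univ fun S => if S.card = i then gradedPart ℳ (j - i) else ⊥

/-- The cycles in `K_i(y; M)_j`. -/
def koszulCycles (ℳ : ℕ → AddSubgroup M) {n : ℕ} (y : Fin n → A) (i : ℕ) (j : ℤ) :
    AddSubgroup (Finset (Fin n) → M) :=
  koszulChains ℳ n i j ⊓ (LinearMap.ker (koszulD (M := M) y)).toAddSubgroup

/-- The boundaries in `K_i(y; M)_j`. -/
def koszulBoundaries (ℳ : ℕ → AddSubgroup M) {n : ℕ} (y : Fin n → A) (i : ℕ) (j : ℤ) :
    AddSubgroup (Finset (Fin n) → M) :=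
  (koszulChains ℳ n (i + 1) j).map (koszulD (M := M) y).toAddMonoidHom

/-- The component `H_i(y; M)_j` of degree `j` of the `i`th Koszul homology, for `y₁, …, yₙ` of
degree one. -/
abbrev KoszulHomology (ℳ : ℕ → AddSubgroup M) {n : ℕ} (y : Fin n → A) (i : ℕ) (j : ℤ) : Type _ :=
  koszulCycles ℳ y i j ⧸ (koszulBoundaries ℳ y i j).addSubgroupOf (koszulCycles ℳ y i j)

/-- The Castelnuovo–Mumford regularity of the graded module `M = ⨁ M_k`, computed by the system
`y` of generators of the ideal of positive-degree elements, is
`r = max {j - i | H_i(y; M)_j ≠ 0}`; the maximum is required to exist. -/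
def IsRegularity (ℳ : ℕ → AddSubgroup M) {n : ℕ} (y : Fin n → A) (r : ℤ) : Prop :=
  IsGreatest {d : ℤ | ∃ (i : ℕ) (j : ℤ), d = j - i ∧ Nontrivial (KoszulHomology ℳ y i j)} r

/-- The ideal generated by the elements of positive degree of a graded ring `A = ⨁ A_k`. -/
def irrelevantIdeal (𝒜 : ℕ → AddSubgroup A) : Ideal A :=
  Ideal.span {a | ∃ k > 0, a ∈ 𝒜 k}

/-- `y₁, …, yₙ` is a minimal homogeneous system of generators of the ideal `A₊` of a standard
graded ring `A`; as `A₊` is generated in degree one, its members all have degree one. -/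
structure IsMinimalGenerators (𝒜 : ℕ → AddSubgroup A) {n : ℕ} (y : Fin n → A) : Prop where
  degree_one : ∀ i, y i ∈ 𝒜 1
  span_eq : Ideal.span (Set.range y) = irrelevantIdeal 𝒜
  minimal : ∀ i, Ideal.span (y '' {i}ᶜ) ≠ irrelevantIdeal 𝒜

end Koszul

/-! ### The Rees algebra `⨁ mᵏ` and its ideal `⨁ I mᵏ` -/

section Rees

variable {R : Type*} [CommRing R]

/-- The component of degree `k` of the Rees algebra `⨁ mᵏ tᵏ ⊆ R[t]`. -/
noncomputable def reesPart (m : Ideal R) (k : ℕ) : AddSubgroup (reesAlgebra m) :=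
  (LinearMap.range (Polynomial.monomial (R := R) k)).toAddSubgroup.comap
    ((reesAlgebra m).val : reesAlgebra m →+ Polynomial R)

/-- The extension `⨁ I mᵏ` of the ideal `I` to the Rees algebra of `m`. -/
noncomputable def reesIdeal (m I : Ideal R) : Ideal (reesAlgebra m) :=
  I.map (algebraMap R (reesAlgebra m))

/-- The component of degree `k` (a copy of `I mᵏ`) of the graded module `⨁ I mᵏ`. -/
noncomputable def reesIdealPart (m I : Ideal R) (k : ℕ) : AddSubgroup (reesIdeal m I) :=
  (reesPart m k).comap ((reesIdeal m I).subtype : reesIdeal m I →+ reesAlgebra m)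

end Rees

/-! The heart is superficiality: for generic `x`, `(I mⁿ⁺¹ : x) = I mⁿ` for all large `n`
(`exists_generic_eventually_colon_eq`). It follows from prime avoidance in `m / m²`, applied to the
degree-one parts of the associated primes of `⨁ I mᵏ⁺¹` in the Rees algebra and to two finite sets
of associated primes in `R`, combined with Artin–Rees.

Since `(J m : m) ⊆ (J m : x)`, superficiality makes `I mᵏ` weakly `m`-full for large `k`, so `d₃`
exists. Suppose `I mᵏ` is weakly `m`-full for all `k ≥ ℓ`, and let `x z ∈ I mᵏ⁺¹`. Then `x z mᶜ ⊆ I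
mᵏ⁺ᶜ⁺¹`, hence `z mᶜ ⊆ I mᵏ⁺ᶜ` for large `c`, and weak fullness strips off the factors `m` one by
one: `z ∈ I mᵏ`. So the whole tail is `m`-full (`isMFull_of_forall_isWeaklyMFull`). As `m`-full
ideals are full and weakly `m`-full, `d₂ ≤ d₃ = d₁`.

For the regularity, let `z ∈ (I mᵏ⁺¹ : m)` lie outside `I mᵏ`. The Koszul boundary of `e₁ ∧ ⋯ ∧ eₙ ⊗
z tᵏ`, formed over `R[t]`, has its coefficients in `⨁ I mᵏ`. It is a cycle there but not a boundary,
and gives a class with `j - i = k + 1` (`nontrivial_koszulHomology_of_mem_colon`). So weak fullness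
can fail only at `k < reg`. The maximum exists because the module of cycles is finitely generated
and Koszul homology is killed by the `y_s`.

The local and the graded setting both supply a nonzerodivisor in `m` and the injectivity of every `s
∈ 1 + m` on `R` and `R / I`; the latter stands in for localizing at `m` after Nakayama. -/

/-! ### Homogeneous elements of the Rees algebra -/

section ReesIdeal

open Polynomial

variable {R : Type*} [CommRing R] {m : Ideal R}

/-- The element `r tᵏ` of the Rees algebra, for `r ∈ mᵏ`. -/
noncomputable def reesMonomial (m : Ideal R) (k : ℕ) : ↥(m ^ k) →ₗ[R] reesAlgebra m where
  toFun r := ⟨monomial k (r : R), reesAlgebra.monomial_mem.2 r.2⟩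
  map_add' r s := Subtype.ext (by simp)
  map_smul' r s := Subtype.ext (by simp [smul_monomial])

@[simp]
theorem coe_reesMonomial (k : ℕ) (r : ↥(m ^ k)) :
    (reesMonomial m k r : R[X]) = monomial k (r : R) := rfl

theorem sum_reesMonomial (f : reesAlgebra m) :
    f = ∑ k ∈ (f : R[X]).support, reesMonomial m k ⟨(f : R[X]).coeff k, f.2 k⟩ := by
  refine Subtype.ext ?_
  rw [AddSubmonoidClass.coe_finsetSum]
  exact (f : R[X]).as_sum_support

theorem mem_reesIdeal_iff {I : Ideal R} {f : reesAlgebra m} :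
    f ∈ reesIdeal m I ↔ ∀ k, (f : R[X]).coeff k ∈ I * m ^ k := by
  constructor
  · intro hf
    refine Submodule.span_induction ?_ ?_ ?_ ?_ hf
    · rintro _ ⟨a, ha, rfl⟩ k
      have h : ((algebraMap R (reesAlgebra m) a : reesAlgebra m) : R[X]) = C a := rfl
      rw [h, coeff_C]
      split_ifs with hk
      · subst hk
        simpa using ha
      · exact zero_mem _
    · intro k
      simp
    · intro f g _ _ hf hg k
      simpa using add_mem (hf k) (hg k)
    · intro a f _ hf k
      rw [smul_eq_mul, MulMemClass.coe_mul, coeff_mul]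
      refine Ideal.sum_mem _ fun p hp => ?_
      rw [← Finset.HasAntidiagonal.mem_antidiagonal.1 hp, pow_add, mul_left_comm]
      exact Ideal.mul_mem_mul (a.2 _) (hf _)
  · intro hf
    rw [sum_reesMonomial f]
    refine Ideal.sum_mem _ fun k _ => ?_
    have key : ∀ r ∈ I * m ^ k, ∀ h : r ∈ m ^ k, reesMonomial m k ⟨r, h⟩ ∈ reesIdeal m I := by
      intro r hr
      induction hr using Submodule.mul_induction_on' with
      | mem_mul_mem a ha b hb =>
        intro h
        have : reesMonomial m k ⟨a * b, h⟩ =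
            algebraMap R (reesAlgebra m) a * reesMonomial m k ⟨b, hb⟩ := by
          rw [← Algebra.smul_def, ← map_smul]
          rfl
        rw [this]
        exact Ideal.mul_mem_right _ _ (Ideal.mem_map_of_mem _ ha)
      | add x hx y hy h1 h2 =>
        intro h
        have hx' : x ∈ m ^ k := Ideal.mul_le_right hx
        have hy' : y ∈ m ^ k := Ideal.mul_le_right hy
        have : reesMonomial m k ⟨x + y, h⟩ =
            reesMonomial m k ⟨x, hx'⟩ + reesMonomial m k ⟨y, hy'⟩ :=
          map_add (reesMonomial m k) ⟨x, hx'⟩ ⟨y, hy'⟩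
        rw [this]
        exact add_mem (h1 _) (h2 _)
    exact key _ (hf k) _

theorem reesMonomial_mem_reesIdeal_iff {I : Ideal R} {k : ℕ} {r : ↥(m ^ k)} :
    reesMonomial m k r ∈ reesIdeal m I ↔ (r : R) ∈ I * m ^ k := by
  rw [mem_reesIdeal_iff]
  constructor
  · intro h
    simpa using h k
  · intro h j
    rw [coe_reesMonomial, coeff_monomial]
    split_ifs with hj
    · exact hj ▸ h
    · exact zero_mem _

/-- The part of degree one of an ideal of the Rees algebra, as an ideal of the base ring. -/
noncomputable def degreeOnePart (P : Ideal (reesAlgebra m)) : Ideal R :=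
  ((P.restrictScalars R).map (reesAlgebra m).val.toLinearMap).comap (monomial 1)

theorem mem_degreeOnePart {P : Ideal (reesAlgebra m)} {a : R} :
    a ∈ degreeOnePart P ↔ ∃ h : a ∈ m ^ 1, reesMonomial m 1 ⟨a, h⟩ ∈ P := by
  constructor
  · rintro ⟨y, hy, hya⟩
    have hya' : (y : R[X]) = monomial 1 a := hya
    have ha : a ∈ m ^ 1 := by
      have := y.2 1
      rwa [hya', coeff_monomial, if_pos rfl] at this
    refine ⟨ha, ?_⟩
    rwa [show reesMonomial m 1 ⟨a, ha⟩ = y from Subtype.ext hya'.symm]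
  · rintro ⟨h, hP⟩
    exact ⟨_, hP, rfl⟩

end ReesIdeal

/-! ### Generic elements -/

section Generic

open Polynomial

variable {R : Type*} [CommRing R] {m : Ideal R}

/-- Nakayama without a local ring: `s` plays the role of a unit at `m`. -/
theorem exists_sub_one_mem_and_mul_mem [IsNoetherianRing R] {p : Ideal R}
    (h : m ≤ p ⊔ m ^ 2) : ∃ s, s - 1 ∈ m ∧ ∀ a ∈ m, s * a ∈ p := by
  rw [pow_two] at h
  obtain ⟨s, hs, hsp⟩ := Submodule.exists_sub_one_mem_and_smul_le_of_fg_of_le_sup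
    (I := m) (N := p) (N' := m) (P := m) (IsNoetherian.noetherian m) le_rfl h
  exact ⟨s, hs, fun a ha => hsp (Submodule.smul_mem_pointwise_smul a s m ha)⟩

/-- The image of `p ∩ m` in `m / m²`. -/
def cotangentImage (m p : Ideal R) : Submodule (R ⧸ m) m.Cotangent where
  carrier := {v | ∃ x : m, (x : R) ∈ p ∧ m.toCotangent x = v}
  add_mem' := by
    rintro _ _ ⟨x, hx, rfl⟩ ⟨y, hy, rfl⟩
    exact ⟨x + y, p.add_mem hx hy, map_add _ _ _⟩
  zero_mem' := ⟨0, p.zero_mem, map_zero _⟩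
  smul_mem' := by
    rintro c _ ⟨x, hx, rfl⟩
    obtain ⟨c, rfl⟩ := Ideal.Quotient.mk_surjective c
    exact ⟨c • x, p.mul_mem_left c hx, map_smul _ _ _⟩

theorem cotangentImage_ne_top {p : Ideal R} (h : ¬ m ≤ p ⊔ m ^ 2) : cotangentImage m p ≠ ⊤ := by
  contrapose! h
  intro a ha
  obtain ⟨x, hx, hxa⟩ : m.toCotangent ⟨a, ha⟩ ∈ cotangentImage m p := h ▸ Submodule.mem_top
  rw [Ideal.toCotangent_eq] at hxa
  have : a = x - (x - a) := by ring
  rw [this]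
  exact sub_mem (Ideal.mem_sup_left hx) (Ideal.mem_sup_right hxa)

/-- Prime avoidance in `m / m²`: each `p` has a proper image there, which lies in the kernel of a
nonzero linear form, and a vector space over an infinite field is not a finite union of hyperplanes.
The open set is the nonvanishing locus of the product of these forms. -/
theorem exists_isZariskiOpen_forall_notMem [hm : m.IsMaximal] [Infinite (R ⧸ m)]
    {S : Set (Ideal R)} (hS : S.Finite) (h : ∀ p ∈ S, ¬ m ≤ p ⊔ m ^ 2) :
    ∃ U : Set m.Cotangent, IsZariskiOpen (R ⧸ m) U ∧ U.Nonempty ∧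
      ∀ x : m, m.toCotangent x ∈ U → ∀ p ∈ S, (x : R) ∉ p := by
  let _ : Field (R ⧸ m) := Ideal.Quotient.field m
  have hφ : ∀ p : Ideal R, ∃ φ : Module.Dual (R ⧸ m) m.Cotangent,
      p ∈ S → φ ≠ 0 ∧ cotangentImage m p ≤ LinearMap.ker φ := by
    intro p
    by_cases hp : p ∈ S
    · obtain ⟨φ, hφ⟩ := Submodule.exists_le_ker_of_lt_top _
        (lt_top_iff_ne_top.2 (cotangentImage_ne_top (h p hp)))
      exact ⟨φ, fun _ => hφ⟩
    · exact ⟨0, fun h => absurd h hp⟩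
  choose φ hφ using hφ
  let f : m.Cotangent → R ⧸ m := ∏ p ∈ hS.toFinset, ⇑(φ p)
  have hf : ∀ v, f v ≠ 0 ↔ ∀ p ∈ S, φ p v ≠ 0 := by
    intro v
    simp [f, Finset.prod_apply, Finset.prod_ne_zero_iff]
  refine ⟨{v | ∃ g ∈ ({f} : Set (m.Cotangent → R ⧸ m)), g v ≠ 0}, ⟨{f}, ?_, rfl⟩, ?_, ?_⟩
  · rw [Set.singleton_subset_iff]
    exact Subalgebra.prod_mem _ fun p _ => Algebra.subset_adjoin ⟨φ p, rfl⟩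
  · have := Subspace.biUnion_ne_univ_of_top_notMem (k := R ⧸ m) (E := m.Cotangent)
      (s := hS.toFinset.image fun p => LinearMap.ker (φ p)) (by
        simp only [Finset.mem_image, not_exists, not_and]
        intro p hp hker
        exact (hφ p (hS.mem_toFinset.1 hp)).1 (LinearMap.ker_eq_top.1 hker))
    obtain ⟨v, hv⟩ := (Set.ne_univ_iff_exists_notMem _).1 this
    refine ⟨v, f, rfl, (hf v).2 fun p hp hpv => hv ?_⟩
    simp only [Finset.mem_image, Set.mem_iUnion]
    exact ⟨_, ⟨p, hS.mem_toFinset.2 hp, rfl⟩, hpv⟩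
  · rintro x ⟨g, rfl, hx⟩ p hp hxp
    exact (hf _).1 hx p hp ((hφ p hp).2 ⟨x, hxp, rfl⟩)

/-- Restriction to the line through `w`, which reduces nonvanishing to finiteness of the roots in
one variable. -/
theorem exists_polynomial_eval_eq {k V : Type*} [CommRing k] [AddCommGroup V] [Module k V]
    {f : V → k} (hf : f ∈ polyFunctions k V) (w : V) : ∃ q : k[X], ∀ t, f (t • w) = q.eval t := by
  refine Algebra.adjoin_induction ?_ ?_ ?_ ?_ hf
  · rintro _ ⟨φ, rfl⟩
    exact ⟨X * C (φ w), fun t => by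
      rw [map_smul, eval_mul, eval_X, eval_C, smul_eq_mul]⟩
  · exact fun r => ⟨C r, fun t => by simp⟩
  · rintro f g _ _ ⟨p, hp⟩ ⟨q, hq⟩
    exact ⟨p + q, fun t => by simp [hp, hq]⟩
  · rintro f g _ _ ⟨p, hp⟩ ⟨q, hq⟩
    exact ⟨p * q, fun t => by simp [hp, hq]⟩

/-- A nonempty Zariski open subset of a nonzero vector space over an infinite field contains a
nonzero vector. -/
theorem IsZariskiOpen.exists_ne_zero {k V : Type*} [Field k] [Infinite k] [AddCommGroup V]
    [Module k V] [Nontrivial V] {U : Set V} (hU : IsZariskiOpen k U) (hne : U.Nonempty) :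
    ∃ v ∈ U, v ≠ 0 := by
  classical
  obtain ⟨S, hS, rfl⟩ := hU
  obtain ⟨v, f, hf, hv⟩ := hne
  by_cases hv0 : v = 0
  · obtain ⟨w, hw⟩ := exists_ne (0 : V)
    obtain ⟨q, hq⟩ := exists_polynomial_eval_eq (hS hf) w
    have hq0 : q ≠ 0 := by
      rintro rfl
      exact hv (by simpa [hv0] using hq 0)
    obtain ⟨t, ht⟩ := Infinite.exists_notMem_finset (insert 0 q.roots.toFinset)
    simp only [Finset.mem_insert, Multiset.mem_toFinset, mem_roots hq0, IsRoot.def, not_or] at ht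
    exact ⟨t • w, ⟨f, hf, by rw [hq]; exact ht.2⟩, smul_ne_zero ht.1 hw⟩
  · exact ⟨v, ⟨f, hf, hv⟩, hv0⟩

end Generic

/-! ### Associated primes and superficial elements -/

section GenericColon

open Polynomial

/-- An element outside an ideal `Q` of a Noetherian ring has a multiple whose annihilator modulo
`Q` is one of the finitely many associated primes of `Q`. -/
theorem exists_mem_associatedPrimes_forall_mem_iff {A : Type*} [CommRing A] [IsNoetherianRing A]
    {Q : Ideal A} {w : A} (hw : w ∉ Q) :
    ∃ P ∈ associatedPrimes A (A ⧸ Q), ∃ b, b * w ∉ Q ∧ ∀ c, c ∈ P ↔ c * (b * w) ∈ Q := by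
  -- An associated prime of the cyclic submodule generated by `w` is the annihilator of a multiple
  -- of `w`.
  let W : Submodule A (A ⧸ Q) := Submodule.span A {Ideal.Quotient.mk Q w}
  obtain ⟨P, hP, -⟩ := exists_le_isAssociatedPrime_of_isNoetherianRing A
    (⟨Ideal.Quotient.mk Q w, Submodule.mem_span_singleton_self _⟩ : W) (by
      rw [Ne, ← Subtype.coe_inj]
      exact fun h => hw (Ideal.Quotient.eq_zero_iff_mem.1 h))
  have hPass := hP.map_of_injective W.subtype W.injective_subtype
  obtain ⟨hprime, ⟨v, hv⟩, rfl⟩ := (isAssociatedPrime_iff).1 hP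
  obtain ⟨b, rfl⟩ := Submodule.mem_span_singleton.1 hv
  have hmem : ∀ c, c ∈ (⊥ : Submodule A W).colon {⟨b • Ideal.Quotient.mk Q w, hv⟩} ↔
      c * (b * w) ∈ Q := by
    intro c
    rw [Submodule.mem_colon_singleton, Submodule.mem_bot, ← Subtype.coe_inj]
    change Ideal.Quotient.mk Q (c * (b * w)) = 0 ↔ _
    exact Ideal.Quotient.eq_zero_iff_mem
  refine ⟨_, hPass, b, fun h => hprime.ne_top ((Ideal.eq_top_iff_one _).2 ((hmem 1).2 ?_)), hmem⟩
  rwa [one_mul]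

variable {R : Type*} [CommRing R] {m : Ideal R}

/-- If `P = (H : w)` filled `m` modulo `m²`, Nakayama would give `s ∈ 1 + m` with `s m w ⊆ H`, so `w
∈ H` and `P` would be the unit ideal. -/
theorem not_le_sup_sq_of_mem_associatedPrimes [IsNoetherianRing R] {H : Ideal R}
    (hH : ∀ s w, s - 1 ∈ m → (∀ a ∈ m, s * a * w ∈ H) → w ∈ H) {P : Ideal R}
    (hP : P ∈ associatedPrimes R (R ⧸ H)) : ¬ m ≤ P ⊔ m ^ 2 := by
  intro h
  obtain ⟨s, hs, hsP⟩ := exists_sub_one_mem_and_mul_mem h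
  obtain ⟨hprime, w, rfl⟩ := (isAssociatedPrime_iff).1 hP
  obtain ⟨w, rfl⟩ := Ideal.Quotient.mk_surjective w
  refine hprime.ne_top ((Ideal.eq_top_iff_one _).2 ?_)
  have hw : w ∈ H := hH s w hs fun a ha => by
    have := hsP a ha
    rw [Submodule.mem_colon_singleton, Submodule.mem_bot, Algebra.smul_def,
      Ideal.Quotient.algebraMap_eq, ← map_mul, Ideal.Quotient.eq_zero_iff_mem] at this
    exact this
  rw [Submodule.mem_colon_singleton, Ideal.Quotient.eq_zero_iff_mem.2 hw, smul_zero]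
  exact zero_mem _

theorem mem_of_mul_mem_of_forall_associatedPrimes_notMem [IsNoetherianRing R] {H : Ideal R}
    {x z : R} (hx : ∀ P ∈ associatedPrimes R (R ⧸ H), x ∉ P) (h : x * z ∈ H) : z ∈ H := by
  by_contra hz
  obtain ⟨P, hP, b, -, hmem⟩ := exists_mem_associatedPrimes_forall_mem_iff hz
  refine hx P hP ((hmem x).2 ?_)
  rw [mul_left_comm]
  exact H.mul_mem_left b h

theorem coeff_mul_reesMonomial_one (f : reesAlgebra m) (a : ↥(m ^ 1)) (k : ℕ) :
    ((reesMonomial m 1 a * f : reesAlgebra m) : R[X]).coeff (k + 1) =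
      a * (f : R[X]).coeff k := by
  rw [MulMemClass.coe_mul, coe_reesMonomial, coeff_monomial_mul]

/-- The elements of `⨁ I mᵏ / I mᵏ⁺¹` killed by the elements of degree one live in bounded
degrees. -/
theorem exists_forall_coeff_mem_of_forall_reesMonomial_one_mul_mem [IsNoetherianRing R]
    (m I : Ideal R) :
    ∃ D, ∀ f ∈ reesIdeal m I, (∀ a, reesMonomial m 1 a * f ∈ reesIdeal m (I * m)) →
      ∀ k > D, (f : R[X]).coeff k ∈ I * m * m ^ k := by
  -- The elements in question form a finitely generated ideal, and `D` bounds the degrees of its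
  -- generators. In a multiple `a f`, coefficients of `a` of positive degree already carry `f` into
  -- `⨁ I mᵏ⁺¹`, so only the constant coefficient of `a` matters.
  obtain ⟨G, hG⟩ := IsNoetherian.noetherian
    (reesIdeal m I ⊓ (reesIdeal m (I * m)).colon (Set.range (reesMonomial m 1)))
  have hT : ∀ f, f ∈ Submodule.span (reesAlgebra m) (G : Set (reesAlgebra m)) ↔
      f ∈ reesIdeal m I ∧ ∀ a, reesMonomial m 1 a * f ∈ reesIdeal m (I * m) := by
    intro f
    rw [hG, Submodule.mem_inf, Submodule.mem_colon, Set.forall_mem_range]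
    simp only [smul_eq_mul, mul_comm f]
  refine ⟨G.sup fun g => (g : R[X]).natDegree, fun f hf hfa => ?_⟩
  have hf' := (hT f).2 ⟨hf, hfa⟩
  clear hf hfa
  induction hf' using Submodule.span_induction with
  | mem g hg =>
    intro k hk
    rw [coeff_eq_zero_of_natDegree_lt
      (lt_of_le_of_lt (Finset.le_sup (f := fun g : reesAlgebra m => (g : R[X]).natDegree) hg) hk)]
    exact zero_mem _
  | zero => intro k _; simp
  | add f g _ _ hf hg => intro k hk; simpa using add_mem (hf k hk) (hg k hk)
  | smul a f hfG hf =>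
    intro k hk
    rw [smul_eq_mul, MulMemClass.coe_mul, coeff_mul]
    refine Ideal.sum_mem _ fun p hp => ?_
    rw [Finset.HasAntidiagonal.mem_antidiagonal] at hp
    rcases Nat.eq_zero_or_pos p.1 with h0 | h0
    · rw [h0, zero_add] at hp
      rw [hp]
      exact Ideal.mul_mem_left _ _ (hf k hk)
    · obtain ⟨i, hi⟩ := Nat.exists_eq_add_of_lt h0
      rw [zero_add] at hi
      have h1 : (a : R[X]).coeff p.1 ∈ m ^ i * m ^ 1 := by
        rw [← pow_add, ← hi]
        exact a.2 _
      have h2 : ∀ b ∈ m ^ i * m ^ 1, b * (f : R[X]).coeff p.2 ∈ I * m * m ^ k := by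
        intro b hb
        induction hb using Submodule.mul_induction_on' with
        | mem_mul_mem b hb c hc =>
          have h3 := mem_reesIdeal_iff.1 (((hT f).1 hfG).2 ⟨c, hc⟩) (p.2 + 1)
          rw [coeff_mul_reesMonomial_one] at h3
          rw [mul_assoc b, ← hp, hi, show i + 1 + p.2 = i + (p.2 + 1) by ring, pow_add m i,
            mul_left_comm (I * m)]
          exact Ideal.mul_mem_mul hb h3
        | add x _ y _ hx hy => rw [add_mul]; exact add_mem hx hy
      exact h2 _ h1

theorem finite_associatedPrimes_quotient {A : Type*} [CommRing A] [IsNoetherianRing A]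
    (Q : Ideal A) : (associatedPrimes A (A ⧸ Q)).Finite :=
  associatedPrimes.finite A (A ⧸ Q)

/-- The ideals of the base ring which a superficial element for `I` has to avoid. -/
def superficialAvoid (m I : Ideal R) : Set (Ideal R) :=
  degreeOnePart '' associatedPrimes (reesAlgebra m) (reesAlgebra m ⧸ reesIdeal m (I * m)) ∩
    {p | ¬ m ≤ p ⊔ m ^ 2}

/-- If `z` fails, some associated prime `P` is the annihilator of a multiple `b w` of `w = z tʲ`
modulo `⨁ I mᵏ⁺¹`, and `x t ∈ P`. By the choice of `x`, the degree-one part of `P` fills `m` modulo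
`m²`, so all of degree one kills `b w`. Such elements live in degrees at most `D`, whereas `b w`
starts in degree `j > D`. -/
theorem exists_forall_mem_mul_pow_succ_of_mul_mem [IsNoetherianRing R] (m I : Ideal R) :
    ∃ D, ∀ x ∈ m, (∀ p ∈ superficialAvoid m I, x ∉ p) →
      ∀ j > D, ∀ z ∈ I * m ^ j, x * z ∈ I * m ^ (j + 2) → z ∈ I * m ^ (j + 1) := by
  obtain ⟨D, hD⟩ := exists_forall_coeff_mem_of_forall_reesMonomial_one_mul_mem m I
  refine ⟨D, fun x hxm hx j hj z hz hxz => ?_⟩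
  have hQ : ∀ k, I * m * m ^ k = I * m ^ (k + 1) := fun k => by rw [mul_assoc, ← pow_succ']
  by_contra hzn
  set Q := reesIdeal m (I * m) with hQdef
  set w : reesAlgebra m := reesMonomial m j ⟨z, Ideal.mul_le_right hz⟩ with hw
  have hwM : w ∈ reesIdeal m I := reesMonomial_mem_reesIdeal_iff.2 hz
  have hwQ : w ∉ Q := fun h => hzn (hQ j ▸ reesMonomial_mem_reesIdeal_iff.1 h)
  obtain ⟨P, hPass, b, hbQ, hmem⟩ := exists_mem_associatedPrimes_forall_mem_iff hwQ
  have hx1 : x ∈ m ^ 1 := by rwa [pow_one]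
  have hxP : x ∈ degreeOnePart P := by
    refine mem_degreeOnePart.2 ⟨hx1, (hmem _).2 ?_⟩
    rw [mul_left_comm]
    refine Q.mul_mem_left b ?_
    have hmul : reesMonomial m 1 ⟨x, hx1⟩ * w = reesMonomial m (1 + j)
        ⟨x * z, pow_add m 1 j ▸ Ideal.mul_mem_mul hx1 (Ideal.mul_le_right hz)⟩ :=
      Subtype.ext (by simp [hw, monomial_mul_monomial])
    rw [hmul, hQdef, reesMonomial_mem_reesIdeal_iff, hQ, show 1 + j + 1 = j + 2 by ring]
    exact hxz
  have hbad : m ≤ degreeOnePart P ⊔ m ^ 2 := by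
    by_contra hn
    exact hx _ ⟨⟨P, hPass, rfl⟩, hn⟩ hxP
  obtain ⟨s, hs, hsP⟩ := exists_sub_one_mem_and_mul_mem hbad
  have hbw : b * w ∈ reesIdeal m I := Ideal.mul_mem_left _ _ hwM
  refine hbQ (mem_reesIdeal_iff.2 ?_)
  intro k
  rcases lt_or_ge k j with hkj | hkj
  · have : ((b * w : reesAlgebra m) : R[X]).coeff k = 0 := by
      rw [MulMemClass.coe_mul, hw, coe_reesMonomial, ← C_mul_X_pow_eq_monomial, ← mul_assoc,
        coeff_mul_X_pow', if_neg (by lia)]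
    rw [this]
    exact zero_mem _
  · refine hD (b * w) hbw (fun a => ?_) k (lt_of_lt_of_le hj hkj)
    have h1 : s * (a : R) ∈ m ^ 1 := Ideal.mul_mem_left _ _ a.2
    obtain ⟨h2, h3⟩ := mem_degreeOnePart.1 (hsP a (by simpa using a.2))
    have h4 : s • (reesMonomial m 1 a * (b * w)) ∈ Q := by
      have := (hmem _).1 h3
      rwa [show reesMonomial m 1 ⟨s * (a : R), h2⟩ = s • reesMonomial m 1 a from
        map_smul (reesMonomial m 1) s a, smul_mul_assoc] at this
    -- Since `s - 1 ∈ m` maps `⨁ I mᵏ` into `⨁ I mᵏ⁺¹`, the factor `s` can be dropped.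
    have h5 : (s - 1) • (reesMonomial m 1 a * (b * w)) ∈ Q := by
      rw [mem_reesIdeal_iff]
      intro k
      have h6 := mem_reesIdeal_iff.1
        (Ideal.mul_mem_left (reesIdeal m I) (reesMonomial m 1 a) hbw) k
      have h7 : (((s - 1) • (reesMonomial m 1 a * (b * w)) : reesAlgebra m) : R[X]).coeff k =
          (s - 1) * ((reesMonomial m 1 a * (b * w) : reesAlgebra m) : R[X]).coeff k := rfl
      rw [h7, mul_assoc, mul_left_comm I]
      exact Ideal.mul_mem_mul hs h6
    have h8 := sub_mem h4 h5
    rwa [← sub_smul, sub_sub_cancel, one_smul] at h8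

theorem superficialAvoid_finite [IsNoetherianRing R] (m I : Ideal R) :
    (superficialAvoid m I).Finite :=
  ((finite_associatedPrimes_quotient (reesIdeal m (I * m))).image _).subset Set.inter_subset_left

end GenericColon

/-! ### Existence and comparison of the Dao numbers -/

section Dao

variable {R : Type*} [CommRing R] {m : Ideal R}

/-- For a generic `x`, the equality `(I mⁿ⁺¹ : x) = I mⁿ` holds for all large `n`. -/
theorem exists_generic_eventually_colon_eq [IsNoetherianRing R] [m.IsMaximal] [Infinite (R ⧸ m)]
    {b : R} (hb : b ∈ m) (hreg : ∀ r, b * r = 0 → r = 0)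
    (h0 : ∀ s r, s - 1 ∈ m → s * r = 0 → r = 0) {I : Ideal R}
    (hI : ∀ s r, s - 1 ∈ m → s * r ∈ I → r ∈ I) :
    ∃ U : Set m.Cotangent, IsZariskiOpen (R ⧸ m) U ∧ U.Nonempty ∧
      ∀ x : m, m.toCotangent x ∈ U →
        ∃ c, ∀ n ≥ c, (I * m ^ (n + 1)).colon {(x : R)} = I * m ^ n := by
  -- `H = (I : mᴺ)` is the saturation of `I`; it satisfies `mᴺ H ⊆ I`, and a generic `x` is a
  -- nonzerodivisor modulo it.
  obtain ⟨N, hN⟩ := monotone_stabilizes_iff_noetherian.2 (inferInstance : IsNoetherian R R)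
    ⟨fun n => I.colon ((m ^ n : Ideal R) : Set R), fun a b hab =>
      Submodule.colon_mono le_rfl (Ideal.pow_le_pow_right hab)⟩
  change ∀ k ≥ N, I.colon ((m ^ N : Ideal R) : Set R) = I.colon ((m ^ k : Ideal R) : Set R) at hN
  set H : Ideal R := I.colon ((m ^ N : Ideal R) : Set R) with hHdef
  have hH : ∀ s w, s - 1 ∈ m → (∀ a ∈ m, s * a * w ∈ H) → w ∈ H := by
    intro s w hs hw
    rw [hN (N + 1) N.le_succ, Submodule.mem_colon]
    intro t ht
    refine hI s _ hs ?_
    rw [SetLike.mem_coe, pow_succ'] at ht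
    induction ht using Submodule.mul_induction_on' with
    | mem_mul_mem a ha t ht =>
      have := Submodule.mem_colon.1 (hw a ha) t ht
      rw [smul_eq_mul] at this ⊢
      convert this using 1
      ring
    | add x _ y _ hx hy => rw [smul_add, mul_add]; exact add_mem hx hy
  have hbot : ∀ s w, s - 1 ∈ m → (∀ a ∈ m, s * a * w ∈ (⊥ : Ideal R)) → w ∈ (⊥ : Ideal R) := by
    intro s w hs hw
    have h1 : b * (s * w) = 0 := by
      rw [← Ideal.mem_bot.1 (hw b hb)]
      ring
    exact h0 s w hs (hreg _ h1)
  obtain ⟨D, hD⟩ := exists_forall_mem_mul_pow_succ_of_mul_mem m I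
  obtain ⟨U, hU, hne, hUx⟩ := exists_isZariskiOpen_forall_notMem (m := m)
    (((finite_associatedPrimes_quotient H).union
      (finite_associatedPrimes_quotient (⊥ : Ideal R))).union (superficialAvoid_finite m I)) (by
    rintro p ((hp | hp) | hp)
    · exact not_le_sup_sq_of_mem_associatedPrimes hH hp
    · exact not_le_sup_sq_of_mem_associatedPrimes hbot hp
    · exact hp.2)
  refine ⟨U, hU, hne, fun x hx => ?_⟩
  have hxH : ∀ z, (x : R) * z ∈ H → z ∈ H := fun z => mem_of_mul_mem_of_forall_associatedPrimes_notMem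
    fun P hP => hUx x hx P (Or.inl (Or.inl hP))
  have hx0 : ∀ z, (x : R) * z = 0 → z = 0 := fun z => mem_of_mul_mem_of_forall_associatedPrimes_notMem
    fun P hP => hUx x hx P (Or.inl (Or.inr hP))
  have hxD := hD x x.2 fun p hp => hUx x hx p (Or.inr hp)
  obtain ⟨k₁, hk₁⟩ := m.exists_pow_inf_eq_pow_smul (Ideal.span {(x : R)})
  obtain ⟨k₂, hk₂⟩ := m.exists_pow_inf_eq_pow_smul H
  simp only [smul_eq_mul, Ideal.mul_top] at hk₁ hk₂
  -- Artin–Rees for `(x)` costs `k₁` powers of `m` and for `H` another `k₂`; then `N` powers push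
  -- `H` into `I`, and `D + 1` remain to start the climb from `I mᴰ⁺¹` to `I mⁿ`.
  refine ⟨k₁ + k₂ + N + (D + 1), fun n hn => le_antisymm (fun z hz => ?_) fun z hz => ?_⟩
  · rw [Submodule.mem_colon_singleton, smul_eq_mul] at hz
    have hIH : I ≤ H := fun r hr => Submodule.mem_colon.2 fun t _ => I.mul_mem_right t hr
    have hzH : z ∈ H := hxH z (hIH (by rw [mul_comm]; exact Ideal.mul_le_left hz))
    have hzm : z ∈ m ^ (n + 1 - k₁) := by
      have h1 : z * x ∈ m ^ (n + 1 - k₁) * (m ^ k₁ ⊓ Ideal.span {(x : R)}) := by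
        rw [← hk₁ (n + 1) (by lia)]
        exact ⟨Ideal.mul_le_right hz, Ideal.mul_mem_left _ _ (Ideal.mem_span_singleton_self _)⟩
      have h2 := Ideal.mul_mono_right (I := m ^ (n + 1 - k₁)) inf_le_right h1
      rw [Ideal.mem_mul_span_singleton] at h2
      obtain ⟨z', hz', h3⟩ := h2
      have h4 : z' - z = 0 := hx0 _ (by rw [mul_sub, mul_comm, h3, mul_comm z, sub_self])
      rwa [← sub_eq_zero.1 h4]
    have hzI : z ∈ I * m ^ (D + 1) := by
      have h1 : z ∈ m ^ (n + 1 - k₁ - k₂) * (m ^ k₂ ⊓ H) := by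
        rw [← hk₂ (n + 1 - k₁) (by lia)]
        exact ⟨hzm, hzH⟩
      have h2 := Ideal.mul_mono_right (I := m ^ (n + 1 - k₁ - k₂)) inf_le_right h1
      have h3 := Ideal.mul_mono_left (K := H)
        (Ideal.pow_le_pow_right (I := m) (show D + 1 + N ≤ n + 1 - k₁ - k₂ by lia)) h2
      rw [pow_add, mul_assoc, mul_comm] at h3
      refine Ideal.mul_mono_left (Ideal.mul_le.2 fun t ht r hr => ?_) h3
      rw [mul_comm]
      exact Submodule.mem_colon.1 hr t ht
    have key : ∀ j, D + 1 + j ≤ n → z ∈ I * m ^ (D + 1 + j) := by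
      intro j
      induction j with
      | zero => exact fun _ => hzI
      | succ j ih =>
        intro hj
        refine hxD (D + 1 + j) (by lia) z (ih (by lia)) ?_
        rw [mul_comm _ z]
        exact Ideal.mul_mono_right (Ideal.pow_le_pow_right (by lia)) hz
    have := key (n - (D + 1)) (by lia)
    rwa [show D + 1 + (n - (D + 1)) = n by lia] at this
  · rw [Submodule.mem_colon_singleton, smul_eq_mul, pow_succ, ← mul_assoc]
    exact Ideal.mul_mem_mul hz x.2

theorem IsDaoNumber.exists_of_nonempty {P : Ideal R → Ideal R → Prop} {I : Ideal R} {ℓ : ℕ}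
    (h : ∀ k ≥ ℓ, P m (I * m ^ k)) : ∃ d ≤ ℓ, IsDaoNumber P m I d := by
  classical
  have hex : ∃ ℓ, ∀ k ≥ ℓ, P m (I * m ^ k) := ⟨ℓ, h⟩
  exact ⟨Nat.find hex, Nat.find_min' hex h, Nat.find_spec hex, fun d hd => Nat.find_min' hex hd⟩

/-- If `r x ∈ I`, then `(r y) x ∈ I m` for `y ∈ m`, so `r y ∈ (I m : x) = I`. -/
theorem IsMFull.isFull {I : Ideal R} (h : IsMFull m I) : IsFull m I := by
  obtain ⟨U, hU, hne, hx⟩ := h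
  refine ⟨U, hU, hne, fun x hx2 hxU => le_antisymm (fun r hr => ?_) ?_⟩
  · rw [Submodule.mem_colon_singleton, smul_eq_mul] at hr
    rw [Submodule.mem_colon]
    intro y hy
    rw [← hx x hx2 hxU, Submodule.mem_colon_singleton, smul_eq_mul, smul_eq_mul, mul_right_comm]
    exact Ideal.mul_mem_mul hr hy
  · exact Submodule.colon_mono le_rfl (Set.singleton_subset_iff.2 x.2)

theorem le_mul_colon (m I : Ideal R) : I ≤ (I * m).colon (m : Set R) := fun _ hr =>
  Submodule.mem_colon.2 fun _ ht => Ideal.mul_mem_mul hr ht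

theorem IsMFull.isWeaklyMFull [m.IsMaximal] [Infinite (R ⧸ m)] [Nontrivial m.Cotangent]
    {I : Ideal R} (h : IsMFull m I) : IsWeaklyMFull m I := by
  let _ : Field (R ⧸ m) := Ideal.Quotient.field m
  obtain ⟨U, hU, hne, hx⟩ := h
  obtain ⟨v, hvU, hv⟩ := IsZariskiOpen.exists_ne_zero hU hne
  obtain ⟨x, rfl⟩ := m.toCotangent_surjective v
  refine le_antisymm ?_ (le_mul_colon m I)
  rw [Ne, Ideal.toCotangent_eq_zero] at hv
  conv_rhs => rw [← hx x hv hvU]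
  exact Submodule.colon_mono le_rfl (Set.singleton_subset_iff.2 x.2)

theorem mem_mul_pow_of_forall_isWeaklyMFull {I : Ideal R} {ℓ : ℕ}
    (h : ∀ k ≥ ℓ, IsWeaklyMFull m (I * m ^ k)) {k : ℕ} (hk : ℓ ≤ k) (j : ℕ) {z : R}
    (hz : ∀ t ∈ m ^ j, z * t ∈ I * m ^ (k + j)) : z ∈ I * m ^ k := by
  induction j with
  | zero => simpa using hz 1 (by simp)
  | succ j ih =>
    refine ih fun t ht => ?_
    rw [← h (k + j) (by lia), Submodule.mem_colon]
    intro a ha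
    rw [smul_eq_mul, mul_assoc, mul_assoc, ← pow_succ]
    exact hz _ (pow_succ m j ▸ Ideal.mul_mem_mul ht ha)

/-- If `I mᵏ` is weakly `m`-full for all `k ≥ ℓ`, then it is `m`-full for all `k ≥ ℓ`, provided
that `(I mⁿ⁺¹ : x) = I mⁿ` for generic `x` and large `n`. -/
theorem isMFull_of_forall_isWeaklyMFull {I : Ideal R}
    (hgen : ∃ U : Set m.Cotangent, IsZariskiOpen (R ⧸ m) U ∧ U.Nonempty ∧
      ∀ x : m, m.toCotangent x ∈ U →
        ∃ c, ∀ n ≥ c, (I * m ^ (n + 1)).colon {(x : R)} = I * m ^ n) {ℓ : ℕ}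
    (h : ∀ k ≥ ℓ, IsWeaklyMFull m (I * m ^ k)) {k : ℕ} (hk : ℓ ≤ k) : IsMFull m (I * m ^ k) := by
  obtain ⟨U, hU, hne, hx⟩ := hgen
  refine ⟨U, hU, hne, fun x _ hxU => le_antisymm (fun z hz => ?_) fun z hz => ?_⟩
  · obtain ⟨c, hc⟩ := hx x hxU
    refine mem_mul_pow_of_forall_isWeaklyMFull h hk c fun t ht => ?_
    rw [← hc (k + c) (by lia), Submodule.mem_colon_singleton, smul_eq_mul, mul_right_comm,
      show k + c + 1 = k + 1 + c by ring, pow_add, ← mul_assoc]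
    rw [Submodule.mem_colon_singleton, smul_eq_mul, mul_assoc, ← pow_succ] at hz
    exact Ideal.mul_mem_mul hz ht
  · rw [Submodule.mem_colon_singleton, smul_eq_mul]
    exact Ideal.mul_mem_mul hz x.2

/-- The three Dao numbers exist, and `d₂ ≤ d₃ = d₁`. -/
theorem exists_isDaoNumber [IsNoetherianRing R] [m.IsMaximal] [Infinite (R ⧸ m)]
    {b : R} (hb : b ∈ m) (hreg : ∀ r, b * r = 0 → r = 0)
    (h0 : ∀ s r, s - 1 ∈ m → s * r = 0 → r = 0) {I : Ideal R}
    (hI : ∀ s r, s - 1 ∈ m → s * r ∈ I → r ∈ I) :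
    ∃ d₁ d₂, IsDaoNumber IsMFull m I d₁ ∧ IsDaoNumber IsFull m I d₂ ∧
      IsDaoNumber IsWeaklyMFull m I d₁ ∧ d₂ ≤ d₁ := by
  have hgen := exists_generic_eventually_colon_eq hb hreg h0 hI
  -- If `m = m²`, Nakayama gives `s ∈ 1 + m` with `s m = 0`; the nonzerodivisor `b` forces `s = 0`,
  -- so `1 ∈ m`.
  have : Nontrivial m.Cotangent := by
    rw [← not_subsingleton_iff_nontrivial, Ideal.cotangent_subsingleton_iff]
    intro hidem
    obtain ⟨s, hs, hsm⟩ := exists_sub_one_mem_and_mul_mem (m := m) (p := ⊥) (by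
      rw [bot_sup_eq, pow_two, hidem.eq])
    have hs0 : s = 0 := hreg s (by rw [mul_comm]; exact hsm b hb)
    refine Ideal.IsPrime.ne_top (I := m) inferInstance ((Ideal.eq_top_iff_one m).2 ?_)
    simpa [hs0] using hs
  have hweak : ∃ ℓ, ∀ k ≥ ℓ, IsWeaklyMFull m (I * m ^ k) := by
    obtain ⟨U, -, ⟨v, hv⟩, hx⟩ := hgen
    obtain ⟨x, rfl⟩ := m.toCotangent_surjective v
    obtain ⟨c, hc⟩ := hx x hv
    refine ⟨c, fun k hk => le_antisymm ?_ (le_mul_colon _ _)⟩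
    conv_rhs => rw [← hc k hk]
    rw [mul_assoc, ← pow_succ]
    exact Submodule.colon_mono le_rfl (Set.singleton_subset_iff.2 x.2)
  obtain ⟨ℓ, hℓ⟩ := hweak
  obtain ⟨d, -, hd⟩ := IsDaoNumber.exists_of_nonempty hℓ
  have hd₁ : ∀ k ≥ d, IsMFull m (I * m ^ k) := fun k hk =>
    isMFull_of_forall_isWeaklyMFull hgen hd.1 hk
  obtain ⟨d₂, hd₂, hd₂'⟩ := IsDaoNumber.exists_of_nonempty fun k hk => (hd₁ k hk).isFull
  exact ⟨d, d₂, ⟨hd₁, fun e he => hd.2 fun k hk => (he k hk).isWeaklyMFull⟩, hd₂', hd, hd₂⟩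

end Dao

/-! ### Identities in the Koszul complex -/

section KoszulLemmas

variable {A M N : Type*} [CommRing A] [AddCommGroup M] [Module A M] [AddCommGroup N] [Module A N]
  {n : ℕ}

/-- The sign `(-1) ^ #{t ∈ T | t < s}`. -/
def koszulSign (A : Type*) [CommRing A] {n : ℕ} (T : Finset (Fin n)) (s : Fin n) : A :=
  (-1) ^ (T.filter (· < s)).card

theorem koszulD_apply (y : Fin n → A) (c : Finset (Fin n) → M) (T : Finset (Fin n)) :
    koszulD y c T = ∑ s ∈ Tᶜ, (koszulSign A T s * y s) • c (insert s T) := rfl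

theorem koszulSign_mul_self (T : Finset (Fin n)) (s : Fin n) :
    koszulSign A T s * koszulSign A T s = 1 := by
  rw [koszulSign, ← mul_pow]
  simp

theorem koszulSign_insert {T : Finset (Fin n)} {s : Fin n} (hs : s ∉ T) (u : Fin n) :
    koszulSign A (insert s T) u = (if s < u then -1 else 1) * koszulSign A T u := by
  rw [koszulSign, koszulSign, Finset.filter_insert]
  split_ifs with h
  · rw [Finset.card_insert_of_notMem (fun h => hs (Finset.mem_filter.1 h).1), pow_succ']
  · rw [one_mul]

theorem koszulSign_insert_self {T : Finset (Fin n)} {s : Fin n} :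
    koszulSign A (insert s T) s = koszulSign A T s := by
  rw [koszulSign, koszulSign, Finset.filter_insert, if_neg (lt_irrefl s)]

theorem koszulD_comp (y : Fin n → A) (ι : M →ₗ[A] N) (c : Finset (Fin n) → M) :
    koszulD y (fun T => ι (c T)) = fun T => ι (koszulD y c T) := by
  funext T
  simp [koszulD_apply]

theorem koszulD_koszulD (y : Fin n → A) (c : Finset (Fin n) → M) :
    koszulD y (koszulD y c) = 0 := by
  funext T
  simp only [koszulD_apply, Finset.smul_sum, Pi.zero_apply]
  rw [Finset.sum_sigma']
  -- Inserting `s` and `u` in the two orders gives opposite signs.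
  refine Finset.sum_involution (fun p _ => ⟨p.2, p.1⟩) ?_ ?_ ?_ ?_
  · rintro ⟨s, u⟩ h
    simp only [Finset.mem_sigma, Finset.mem_compl, Finset.mem_insert, not_or] at h
    obtain ⟨hs, hus, hu⟩ := h
    rw [Finset.insert_comm u s, smul_smul, smul_smul, ← add_smul, koszulSign_insert hs,
      koszulSign_insert hu]
    have : (if s < u then (-1 : A) else 1) + (if u < s then -1 else 1) = 0 := by
      rcases lt_or_gt_of_ne hus with h | h <;> simp [h, h.not_gt]
    rw [← zero_smul A]
    congr 1
    linear_combination koszulSign A T s * koszulSign A T u * y s * y u * this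
  · rintro ⟨s, u⟩ h _ heq
    simp only [Finset.mem_sigma, Finset.mem_compl, Finset.mem_insert, not_or] at h
    exact h.2.1 (congrArg Sigma.fst heq)
  · rintro ⟨s, u⟩ h
    simp only [Finset.mem_sigma, Finset.mem_compl, Finset.mem_insert, not_or] at h ⊢
    exact ⟨h.2.2, Ne.symm h.2.1, h.1⟩
  · rintro ⟨s, u⟩ _
    rfl

/-- Exterior multiplication by `e_s`, a homotopy on the Koszul complex between zero and the
multiplication by `y_s`. -/
def koszulHomotopy (A : Type*) [CommRing A] [Module A M] (s : Fin n) (c : Finset (Fin n) → M)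
    (T : Finset (Fin n)) : M :=
  if s ∈ T then koszulSign A T s • c (T.erase s) else 0

/-- The Leibniz rule for `e_s ∧ c` on a cycle `c`. If `s ∈ T`, the cycle condition at `T ∖ s`
rewrites the sum; otherwise only the summand inserting `s` survives. -/
theorem koszulD_koszulHomotopy (y : Fin n → A) (s : Fin n) {c : Finset (Fin n) → M}
    (hc : koszulD y c = 0) : koszulD y (koszulHomotopy A s c) = y s • c := by
  funext T
  rw [koszulD_apply, Pi.smul_apply]
  by_cases hs : s ∈ T
  · obtain ⟨T, hsT, rfl⟩ : ∃ T', s ∉ T' ∧ insert s T' = T :=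
      ⟨T.erase s, Finset.notMem_erase s T, Finset.insert_erase hs⟩
    have hcT := congrFun hc T
    have hcompl : Tᶜ = insert s (insert s T)ᶜ := by
      ext u
      simp only [Finset.mem_compl, Finset.mem_insert]
      by_cases hu : u = s
      · simp [hu, hsT]
      · simp [hu]
    rw [koszulD_apply, hcompl, Finset.sum_insert (by simp), Pi.zero_apply] at hcT
    have hterm : ∀ u ∈ (insert s T)ᶜ, (koszulSign A (insert s T) u * y u) •
        koszulHomotopy A s c (insert u (insert s T)) =
        -koszulSign A T s • (koszulSign A T u * y u) • c (insert u T) := by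
      intro u hu
      simp only [Finset.mem_compl, Finset.mem_insert, not_or] at hu
      have herase : (insert s (insert u T)).erase s = insert u T :=
        Finset.erase_insert (by simp [Ne.symm hu.1, hsT])
      rw [koszulHomotopy, if_pos (by simp), Finset.insert_comm u s, herase, koszulSign_insert_self,
        koszulSign_insert hu.2, koszulSign_insert hsT, smul_smul, smul_smul]
      congr 1
      rcases lt_or_gt_of_ne hu.1 with h | h <;> simp only [h, h.not_gt, if_true, if_false] <;> ring
    rw [Finset.sum_congr rfl hterm, ← Finset.smul_sum, ← neg_eq_of_add_eq_zero_right hcT,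
      smul_neg, neg_smul, neg_neg, smul_smul, ← mul_assoc, koszulSign_mul_self, one_mul]
  · rw [Finset.sum_eq_single_of_mem s (Finset.mem_compl.2 hs)]
    · rw [koszulHomotopy, if_pos (Finset.mem_insert_self s T), Finset.erase_insert hs,
        koszulSign_insert_self, smul_smul, mul_right_comm, koszulSign_mul_self, one_mul]
    · intro u _ hu
      rw [koszulHomotopy, if_neg (by simp [Ne.symm hu, hs]), smul_zero]

theorem smul_mem_range_koszulD (y : Fin n → A) {a : A} (ha : a ∈ Ideal.span (Set.range y))
    {c : Finset (Fin n) → M} (hc : koszulD y c = 0) :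
    a • c ∈ LinearMap.range (koszulD (M := M) y) := by
  induction ha using Submodule.span_induction with
  | mem a ha =>
    obtain ⟨s, rfl⟩ := ha
    exact ⟨_, koszulD_koszulHomotopy y s hc⟩
  | zero => rw [zero_smul]; exact zero_mem _
  | add a b _ _ ha hb => rw [add_smul]; exact add_mem ha hb
  | smul b a _ ha => rw [smul_eq_mul, mul_smul]; exact Submodule.smul_mem _ _ ha

theorem koszulD_single_univ_compl (y : Fin n → A) (u : M) (s : Fin n) :
    koszulD y (Pi.single Finset.univ u) {s}ᶜ = (koszulSign A {s}ᶜ s * y s) • u := by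
  rw [koszulD_apply, compl_compl, Finset.sum_singleton, Finset.insert_compl_self, Pi.single_eq_same]

theorem koszulD_single_univ_of_card_ne (y : Fin n → A) (u : M) {T : Finset (Fin n)}
    (hT : T.card + 1 ≠ n) : koszulD y (Pi.single Finset.univ u) T = 0 := by
  rw [koszulD_apply]
  refine Finset.sum_eq_zero fun s hs => ?_
  rw [Pi.single_eq_of_ne, smul_zero]
  intro h
  have := congrArg Finset.card h
  rw [Finset.card_insert_of_notMem (Finset.mem_compl.1 hs), Finset.card_univ,
    Fintype.card_fin] at this
  exact hT this

theorem exists_eq_compl_singleton {T : Finset (Fin n)} (hT : T.card + 1 = n) :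
    ∃ s, T = {s}ᶜ := by
  obtain ⟨s, hs⟩ := Finset.card_eq_one.1 (show Tᶜ.card = 1 by
    rw [Finset.card_compl, Fintype.card_fin]
    lia)
  exact ⟨s, by rw [← hs, compl_compl]⟩

theorem mem_koszulChains_iff {ℳ : ℕ → AddSubgroup M} {i : ℕ} {j : ℤ} {c : Finset (Fin n) → M} :
    c ∈ koszulChains ℳ n i j ↔ (∀ S, S.card = i → c S ∈ gradedPart ℳ (j - i)) ∧
      ∀ S, S.card ≠ i → c S = 0 := by
  rw [koszulChains, AddSubgroup.mem_pi]
  constructor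
  · refine fun h => ⟨fun S hS => ?_, fun S hS => ?_⟩
    · simpa [hS] using h S trivial
    · simpa [hS] using h S trivial
  · rintro ⟨h1, h2⟩ S -
    split_ifs with hS
    · exact h1 S hS
    · exact AddSubgroup.mem_bot.2 (h2 S hS)

theorem nontrivial_koszulHomology_iff {ℳ : ℕ → AddSubgroup M} {y : Fin n → A} {i : ℕ} {j : ℤ} :
    Nontrivial (KoszulHomology ℳ y i j) ↔
      ∃ c ∈ koszulChains ℳ n i j, koszulD y c = 0 ∧ c ∉ koszulBoundaries ℳ y i j := by
  rw [KoszulHomology, QuotientAddGroup.nontrivial_iff, Ne, AddSubgroup.addSubgroupOf_eq_top,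
    SetLike.not_le_iff_exists]
  simp only [koszulCycles, AddSubgroup.mem_inf, and_assoc]
  rfl

end KoszulLemmas

/-! ### Degree bounds and nonvanishing for graded Koszul homology -/

section GradedKoszul

variable {A M N : Type*} [CommRing A] [AddCommGroup M] [Module A M] [AddCommGroup N] [Module A N]

/-- `π k` maps the elements of the graded `A`-module `M = ⨁ M_k` to their components of
degree `k`. -/
structure IsComponentMaps (𝒜 : ℕ → AddSubgroup A) (ℳ : ℕ → AddSubgroup M) (π : ℕ → M →+ M) :
    Prop where
  mem : ∀ k f, π k f ∈ ℳ k
  of_mem : ∀ {k f}, f ∈ ℳ k → π k f = f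
  succ_smul : ∀ k, ∀ a ∈ 𝒜 1, ∀ f, π (k + 1) (a • f) = a • π k f
  smul : ∀ a : A, ∃ a' : ℕ → A, (∀ i, a' i ∈ 𝒜 i) ∧ ∀ k f, π k (a • f) =
    ∑ p ∈ Finset.HasAntidiagonal.antidiagonal k, a' p.1 • π p.2 f
  bounded : ∀ f, ∃ D, ∀ k > D, π k f = 0

variable {n : ℕ} {𝒜 : ℕ → AddSubgroup A} {ℳ : ℕ → AddSubgroup M} {π : ℕ → M →+ M}
  {y : Fin n → A}

theorem koszulSign_smul_mem (ℳ : AddSubgroup M) (T : Finset (Fin n)) (s : Fin n) {f : M}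
    (hf : f ∈ ℳ) : koszulSign A T s • f ∈ ℳ := by
  rcases neg_one_pow_eq_or A (T.filter (· < s)).card with h | h
  · rwa [koszulSign, h, one_smul]
  · rw [koszulSign, h, neg_one_smul]
    exact neg_mem hf

theorem IsComponentMaps.koszulD_component (h : IsComponentMaps 𝒜 ℳ π) (hy : ∀ i, y i ∈ 𝒜 1) (k : ℕ)
    (c : Finset (Fin n) → M) (T : Finset (Fin n)) :
    koszulD y (fun S => π k (c S)) T = π (k + 1) (koszulD y c T) := by
  rw [koszulD_apply, koszulD_apply, map_sum]
  exact Finset.sum_congr rfl fun s _ =>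
    (h.succ_smul k _ (koszulSign_smul_mem (A := A) (𝒜 1) T s (hy s)) _).symm

/-- In large degrees every Koszul cycle is the image of a Koszul chain. -/
theorem IsComponentMaps.exists_forall_mem_range_koszulD [IsNoetherianRing A]
    [Module.Finite A M] (h : IsComponentMaps 𝒜 ℳ π) (hy : IsMinimalGenerators 𝒜 y) :
    ∃ D, ∀ c : Finset (Fin n) → M, koszulD y c = 0 → ∀ k > D,
      (fun T => π k (c T)) ∈ LinearMap.range (koszulD (M := M) y) := by
  obtain ⟨G, hG⟩ := IsNoetherian.noetherian (LinearMap.ker (koszulD (M := M) y))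
  have hcomp : ∀ (c : Finset (Fin n) → M) (k : ℕ), koszulD y c = 0 →
      koszulD y (fun T => π k (c T)) = 0 := by
    intro c k hc
    funext T
    rw [h.koszulD_component hy.degree_one, hc, Pi.zero_apply, map_zero]
  choose deg hdeg using h.bounded
  let deg' : (Finset (Fin n) → M) → ℕ := fun g => Finset.univ.sup fun T => deg (g T)
  refine ⟨G.sup deg', fun c hc => ?_⟩
  rw [← LinearMap.mem_ker, ← hG] at hc
  induction hc using Submodule.span_induction with
  | mem g hg =>
    intro k hk
    have : (fun T => π k (g T)) = 0 := funext fun T =>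
      hdeg _ _ (lt_of_le_of_lt ((Finset.le_sup (f := fun T => deg (g T))
          (Finset.mem_univ T)).trans (Finset.le_sup (f := deg') hg)) hk)
    rw [this]
    exact zero_mem _
  | zero =>
    intro k _
    convert zero_mem (LinearMap.range (koszulD (M := M) y))
    exact map_zero _
  | add f g _ _ hf hg =>
    intro k hk
    convert add_mem (hf k hk) (hg k hk) using 1
    funext T
    exact map_add _ _ _
  | smul a g hgG hg =>
    intro k hk
    have hg0 : koszulD y g = 0 := by rwa [hG] at hgG
    obtain ⟨a', ha', hsmul⟩ := h.smul a
    have : (fun T => π k ((a • g) T)) = ∑ p ∈ Finset.HasAntidiagonal.antidiagonal k,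
        a' p.1 • (fun T => π p.2 (g T)) := by
      funext T
      rw [Finset.sum_apply]
      exact hsmul k (g T)
    rw [this]
    refine Submodule.sum_mem _ fun p hp => ?_
    rw [Finset.HasAntidiagonal.mem_antidiagonal] at hp
    rcases Nat.eq_zero_or_pos p.1 with h0 | h0
    · rw [h0, zero_add] at hp
      rw [hp]
      exact Submodule.smul_mem _ _ (hg k hk)
    · refine smul_mem_range_koszulD y ?_ (hcomp g p.2 hg0)
      rw [hy.span_eq]
      exact Ideal.subset_span ⟨_, h0, ha' _⟩

theorem gradedPart_natCast (ℳ : ℕ → AddSubgroup M) (k : ℕ) : gradedPart ℳ k = ℳ k := by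
  rw [gradedPart, if_pos (Int.natCast_nonneg k), Int.toNat_natCast]

theorem gradedPart_of_neg (ℳ : ℕ → AddSubgroup M) {d : ℤ} (hd : d < 0) : gradedPart ℳ d = ⊥ := by
  rw [gradedPart, if_neg (not_le.2 hd)]

theorem IsComponentMaps.exists_forall_nontrivial_koszulHomology_le [IsNoetherianRing A]
    [Module.Finite A M] (h : IsComponentMaps 𝒜 ℳ π) (hy : IsMinimalGenerators 𝒜 y) :
    ∃ D : ℤ, ∀ (i : ℕ) (j : ℤ), Nontrivial (KoszulHomology ℳ y i j) → j - i ≤ D := by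
  obtain ⟨D, hD⟩ := h.exists_forall_mem_range_koszulD hy
  refine ⟨D, fun i j hij => ?_⟩
  obtain ⟨z, hz, hz0, hzb⟩ := nontrivial_koszulHomology_iff.1 hij
  by_contra! hlt
  obtain ⟨k, hk⟩ : ∃ k : ℕ, j - i = ((k + 1 : ℕ) : ℤ) := ⟨(j - i - 1).toNat, by lia⟩
  obtain ⟨hz1, hz2⟩ := mem_koszulChains_iff.1 hz
  rw [hk, gradedPart_natCast] at hz1
  obtain ⟨c, hc⟩ := hD z hz0 (k + 1) (by lia)
  -- The preimage `c` need not be homogeneous; only its part of homological degree `i + 1` with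
  -- coefficients of degree `k` contributes to `z`.
  let c' : Finset (Fin n) → M := fun S => if S.card = i + 1 then π k (c S) else 0
  refine hzb ⟨c', mem_koszulChains_iff.2 ⟨fun S hS => ?_, fun S hS => if_neg hS⟩, ?_⟩
  · rw [show j - ((i + 1 : ℕ) : ℤ) = (k : ℤ) by lia, gradedPart_natCast]
    simp only [c', if_pos hS]
    exact h.mem _ _
  · funext T
    change koszulD y c' T = z T
    by_cases hT : T.card = i
    · have hzT : z T = koszulD y (fun S => π k (c S)) T := by
        rw [h.koszulD_component hy.degree_one, hc, h.of_mem (h.mem _ _), h.of_mem (hz1 T hT)]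
      rw [hzT, koszulD_apply, koszulD_apply]
      refine Finset.sum_congr rfl fun s hs => ?_
      simp only [c', if_pos (show (insert s T).card = i + 1 by
        rw [Finset.card_insert_of_notMem (Finset.mem_compl.1 hs), hT])]
    · rw [hz2 T hT, koszulD_apply]
      refine Finset.sum_eq_zero fun s hs => ?_
      have : (insert s T).card ≠ i + 1 := by
        rw [Finset.card_insert_of_notMem (Finset.mem_compl.1 hs)]
        lia
      simp only [c', if_neg this, smul_zero]

theorem IsComponentMaps.exists_isRegularity [IsNoetherianRing A] [Module.Finite A M]
    (h : IsComponentMaps 𝒜 ℳ π) (hy : IsMinimalGenerators 𝒜 y) {f : M} (hf : f ∈ ℳ 0)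
    (hf0 : f ≠ 0) : ∃ r : ℤ, 0 ≤ r ∧ IsRegularity ℳ y r := by
  obtain ⟨D, hD⟩ := h.exists_forall_nontrivial_koszulHomology_le hy
  have hzero : Nontrivial (KoszulHomology ℳ y 0 0) := by
    refine nontrivial_koszulHomology_iff.2
      ⟨Pi.single ∅ f, mem_koszulChains_iff.2 ⟨fun S hS => ?_, fun S hS => ?_⟩, ?_, ?_⟩
    · rw [Finset.card_eq_zero.1 hS, Pi.single_eq_same]
      exact hf
    · exact Pi.single_eq_of_ne (by rintro rfl; exact hS rfl) _
    · funext T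
      rw [koszulD_apply]
      refine Finset.sum_eq_zero fun s _ => ?_
      rw [Pi.single_eq_of_ne (Finset.insert_ne_empty s T), smul_zero]
    · rintro ⟨c, hc, hcf⟩
      obtain ⟨h1, h2⟩ := mem_koszulChains_iff.1 hc
      -- One-chains of internal degree `0` have coefficients in degree `-1`, hence vanish.
      have hc0 : c = 0 := by
        funext S
        by_cases hS : S.card = 0 + 1
        · have := h1 S hS
          rwa [gradedPart_of_neg _ (by norm_num), AddSubgroup.mem_bot] at this
        · exact h2 S hS
      have h3 : koszulD y c ∅ = f := (congrFun hcf ∅).trans (Pi.single_eq_same _ _)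
      rw [hc0, map_zero, Pi.zero_apply] at h3
      exact hf0 h3.symm
  obtain ⟨r, hr, hmax⟩ := Int.exists_greatest_of_bdd
    (P := fun d => ∃ (i : ℕ) (j : ℤ), d = j - i ∧ Nontrivial (KoszulHomology ℳ y i j))
    ⟨D, by rintro _ ⟨i, j, rfl, hij⟩; exact hD i j hij⟩ ⟨0, 0, 0, by simp, hzero⟩
  exact ⟨r, hmax 0 ⟨0, 0, by simp, hzero⟩, hr, fun d hd => hmax d hd⟩

/-- If `M` is contained in `N`, an element `u ∉ M_k` of `N` with `y_s u ∈ M_{k + 1}` for all `s`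
yields a nonzero Koszul homology class of `M`. -/
theorem nontrivial_koszulHomology_of_smul_mem {i : ℕ} {y : Fin (i + 1) → A} (ι : M →ₗ[A] N)
    (hι : Function.Injective ι) (hreg : ∀ v : N, (∀ s, y s • v = 0) → v = 0) {k : ℕ} {u : N}
    (hu : ∀ s, ∃ f ∈ ℳ (k + 1), ι f = y s • u) (huk : ∀ f ∈ ℳ k, ι f ≠ u) :
    Nontrivial (KoszulHomology ℳ y i ((k + 1 : ℕ) + i : ℤ)) := by
  let e : Finset (Fin (i + 1)) → N := Pi.single Finset.univ u
  have hex : ∀ T, ∃ f : M, ι f = koszulD y e T ∧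
      (T.card = i → f ∈ ℳ (k + 1)) ∧ (T.card ≠ i → f = 0) := by
    intro T
    by_cases hT : T.card = i
    · obtain ⟨s, rfl⟩ := exists_eq_compl_singleton (show T.card + 1 = i + 1 by rw [hT])
      obtain ⟨f, hf, hfu⟩ := hu s
      refine ⟨koszulSign A {s}ᶜ s • f, ?_, fun _ => koszulSign_smul_mem _ _ _ hf,
        fun h => absurd hT h⟩
      rw [koszulD_single_univ_compl, map_smul, hfu, mul_smul]
    · exact ⟨0, by rw [map_zero, koszulD_single_univ_of_card_ne y _ (by lia)],
        fun h => absurd h hT, fun _ => rfl⟩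
  choose c hce hc1 hc2 using hex
  refine nontrivial_koszulHomology_iff.2 ⟨c, mem_koszulChains_iff.2 ⟨fun S hS => ?_, hc2⟩, ?_, ?_⟩
  · rw [show ((k + 1 : ℕ) + i - i : ℤ) = ((k + 1 : ℕ) : ℤ) by ring, gradedPart_natCast]
    exact hc1 S hS
  · funext T
    refine hι ?_
    rw [← congrFun (koszulD_comp y ι c) T, funext hce, koszulD_koszulD, Pi.zero_apply,
      Pi.zero_apply, map_zero]
  · rintro ⟨c', hc', hcc'⟩
    obtain ⟨h1, h2⟩ := mem_koszulChains_iff.1 hc'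
    have hdc' : koszulD y c' = c := hcc'
    rw [show ((k + 1 : ℕ) + i - (i + 1 : ℕ) : ℤ) = (k : ℤ) by push_cast; ring,
      gradedPart_natCast] at h1
    -- The top Koszul module has rank one, so a chain bounding `c` is `e_univ ⊗ f`; then every `y_s`
    -- kills `ι f - u`.
    have hc'w : (fun T => ι (c' T)) = Pi.single Finset.univ (ι (c' Finset.univ)) := by
      funext T
      by_cases hT : T = Finset.univ
      · rw [hT, Pi.single_eq_same]
      · rw [Pi.single_eq_of_ne hT, h2 T, map_zero]
        intro h
        exact hT (Finset.card_eq_iff_eq_univ T |>.1 (by simpa using h))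
    refine huk _ (h1 Finset.univ (by simp)) (sub_eq_zero.1 (hreg _ fun s => ?_))
    have h3 : koszulD y (Pi.single Finset.univ (ι (c' Finset.univ))) {s}ᶜ = koszulD y e {s}ᶜ := by
      rw [← hc'w, koszulD_comp y ι c', hdc', ← hce]
    rw [koszulD_single_univ_compl, koszulD_single_univ_compl, mul_smul, mul_smul] at h3
    have h4 := congrArg (koszulSign A {s}ᶜ s • ·) h3
    simp only [smul_smul, ← mul_assoc, koszulSign_mul_self, one_mul] at h4
    rw [smul_sub, h4, sub_self]

end GradedKoszul

/-! ### Regularity of `⨁ I mᵏ` -/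

section ReesKoszul

open Polynomial

variable {R : Type*} [CommRing R] {m I : Ideal R}

theorem mem_reesPart_iff {k : ℕ} {f : reesAlgebra m} :
    f ∈ reesPart m k ↔ (f : R[X]) = monomial k ((f : R[X]).coeff k) := by
  constructor
  · rintro ⟨r, hr⟩
    change monomial k r = (f : R[X]) at hr
    rw [← hr, coeff_monomial, if_pos rfl]
  · exact fun h => ⟨_, h.symm⟩

theorem mem_reesIdealPart_iff {k : ℕ} {f : reesIdeal m I} :
    f ∈ reesIdealPart m I k ↔ ((f : reesAlgebra m) : R[X]) =
      monomial k (((f : reesAlgebra m) : R[X]).coeff k) :=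
  mem_reesPart_iff

theorem reesMonomial_mem_reesPart {k : ℕ} (r : ↥(m ^ k)) : reesMonomial m k r ∈ reesPart m k :=
  ⟨r, rfl⟩

theorem reesMonomial_mem_irrelevantIdeal {k : ℕ} (hk : 0 < k) (r : ↥(m ^ k)) :
    reesMonomial m k r ∈ irrelevantIdeal (reesPart m) :=
  Ideal.subset_span ⟨k, hk, reesMonomial_mem_reesPart r⟩

/-- The component of degree `k` of an element of `⨁ I mᵏ`. -/
noncomputable def reesIdealComponent (m I : Ideal R) (k : ℕ) : reesIdeal m I →+ reesIdeal m I where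
  toFun f := ⟨reesMonomial m k ⟨((f : reesAlgebra m) : R[X]).coeff k, f.1.2 k⟩,
    reesMonomial_mem_reesIdeal_iff.2 (mem_reesIdeal_iff.1 f.2 k)⟩
  map_zero' := Subtype.ext (Subtype.ext (by simp))
  map_add' f g := Subtype.ext (Subtype.ext (by simp))

theorem coe_reesIdealComponent (k : ℕ) (f : reesIdeal m I) :
    ((reesIdealComponent m I k f : reesAlgebra m) : R[X]) =
      monomial k (((f : reesAlgebra m) : R[X]).coeff k) := rfl

set_option synthInstance.maxHeartbeats 200000 in
theorem isComponentMaps_reesIdealComponent (m I : Ideal R) :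
    IsComponentMaps (reesPart m) (reesIdealPart m I) (reesIdealComponent m I) where
  mem k f := ⟨_, rfl⟩
  of_mem hf := Subtype.ext (Subtype.ext (mem_reesIdealPart_iff.1 hf).symm)
  succ_smul k a ha f := by
    refine Subtype.ext (Subtype.ext ?_)
    rw [coe_reesIdealComponent]
    change monomial (k + 1) (((a : R[X]) * ((f : reesAlgebra m) : R[X])).coeff (k + 1)) =
      (a : R[X]) * monomial k (((f : reesAlgebra m) : R[X]).coeff k)
    rw [mem_reesPart_iff.1 ha, monomial_mul_monomial, coeff_monomial_mul, add_comm k 1]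
  smul a := by
    refine ⟨fun i => reesMonomial m i ⟨(a : R[X]).coeff i, a.2 i⟩,
      fun i => reesMonomial_mem_reesPart _, fun k f => Subtype.ext (Subtype.ext ?_)⟩
    rw [AddSubmonoidClass.coe_finsetSum, AddSubmonoidClass.coe_finsetSum, coe_reesIdealComponent]
    change monomial k (((a : R[X]) * ((f : reesAlgebra m) : R[X])).coeff k) =
      ∑ p ∈ Finset.HasAntidiagonal.antidiagonal k, monomial p.1 ((a : R[X]).coeff p.1) *
        monomial p.2 (((f : reesAlgebra m) : R[X]).coeff p.2)
    rw [coeff_mul, map_sum]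
    refine Finset.sum_congr rfl fun p hp => ?_
    rw [monomial_mul_monomial, Finset.HasAntidiagonal.mem_antidiagonal.1 hp]
  bounded f := by
    refine ⟨((f : reesAlgebra m) : R[X]).natDegree, fun k hk => Subtype.ext (Subtype.ext ?_)⟩
    rw [coe_reesIdealComponent, coeff_eq_zero_of_natDegree_lt hk, monomial_zero_right]
    rfl

theorem smul_eq_zero_of_mem_span_range {A N σ : Type*} [CommRing A] [AddCommGroup N] [Module A N]
    {y : σ → A} {v : N} (hv : ∀ s, y s • v = 0) {a : A} (ha : a ∈ Ideal.span (Set.range y)) :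
    a • v = 0 := by
  have hle : Ideal.span (Set.range y) ≤ LinearMap.ker (LinearMap.toSpanSingleton A N v) := by
    rw [Ideal.span_le]
    rintro _ ⟨s, rfl⟩
    exact hv s
  exact hle ha

theorem module_finite_ideal {A : Type*} [CommRing A] [IsNoetherianRing A] (J : Ideal A) :
    Module.Finite A J := inferInstance

set_option synthInstance.maxHeartbeats 200000 in
theorem exists_isRegularity_reesIdealPart [IsNoetherianRing R] (hI : I ≠ ⊥) {n : ℕ}
    {y : Fin n → reesAlgebra m} (hy : IsMinimalGenerators (reesPart m) y) :
    ∃ r : ℤ, 0 ≤ r ∧ IsRegularity (reesIdealPart m I) y r := by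
  obtain ⟨a, ha, ha0⟩ := Submodule.exists_mem_ne_zero_of_ne_bot hI
  let f : reesIdeal m I := ⟨reesMonomial m 0 ⟨a, by simp⟩,
    reesMonomial_mem_reesIdeal_iff.2 (by simpa using ha)⟩
  have := module_finite_ideal (reesIdeal m I)
  refine (isComponentMaps_reesIdealComponent m I).exists_isRegularity hy (f := f) ⟨a, rfl⟩ ?_
  intro h
  have h1 := congrArg (fun g : reesIdeal m I => ((g : reesAlgebra m) : R[X]).coeff 0) h
  simp only [f, coe_reesMonomial, coeff_monomial, if_pos] at h1
  exact ha0 h1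

set_option synthInstance.maxHeartbeats 200000 in
/-- An element of `(I mᵏ⁺¹ : m)` outside `I mᵏ` yields a nonzero Koszul homology class. -/
theorem nontrivial_koszulHomology_of_mem_colon {b : R} (hb : b ∈ m)
    (hreg : ∀ r, b * r = 0 → r = 0) {i : ℕ} {y : Fin (i + 1) → reesAlgebra m}
    (hy : IsMinimalGenerators (reesPart m) y) {k : ℕ} {z : R}
    (hz : ∀ a ∈ m, z * a ∈ I * m ^ (k + 1)) (hzk : z ∉ I * m ^ k) :
    Nontrivial (KoszulHomology (reesIdealPart m I) y i ((k + 1 : ℕ) + i : ℤ)) := by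
  -- The ambient module is `R[t]`, since `z tᵏ` need not lie in the Rees algebra.
  let ι : reesIdeal m I →ₗ[reesAlgebra m] R[X] :=
    (Algebra.linearMap (reesAlgebra m) R[X]) ∘ₗ (reesIdeal m I).subtype
  have hι : ∀ f : reesIdeal m I, ι f = ((f : reesAlgebra m) : R[X]) := fun f => rfl
  refine nontrivial_koszulHomology_of_smul_mem ι (fun f g h => Subtype.ext (Subtype.ext h))
    (fun v hv => ?_) (u := monomial k z) (fun s => ?_) (fun f hf hfz => hzk ?_)
  · have hb1 : b ∈ m ^ 1 := by rwa [pow_one]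
    have hmem := reesMonomial_mem_irrelevantIdeal (m := m) one_pos ⟨b, hb1⟩
    rw [← hy.span_eq] at hmem
    have hbv := smul_eq_zero_of_mem_span_range hv hmem
    rw [Subalgebra.smul_def, smul_eq_mul, coe_reesMonomial] at hbv
    ext j
    have := congrArg (fun p : R[X] => p.coeff (j + 1)) hbv
    simp only [coeff_monomial_mul, coeff_zero] at this
    exact hreg _ this
  · have hmem : z * (y s : R[X]).coeff 1 ∈ I * m ^ (k + 1) := hz _ (by simpa using (y s).2 1)
    refine ⟨⟨reesMonomial m (k + 1) ⟨_, Ideal.mul_le_right hmem⟩,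
      reesMonomial_mem_reesIdeal_iff.2 hmem⟩, ⟨_, rfl⟩, ?_⟩
    rw [hι, Subalgebra.smul_def, smul_eq_mul, coe_reesMonomial]
    change monomial (k + 1) (z * (y s : R[X]).coeff 1) = _
    rw [mem_reesPart_iff.1 (hy.degree_one s), monomial_mul_monomial, coeff_monomial, if_pos rfl,
      mul_comm z, add_comm k 1]
  · have h1 := mem_reesIdeal_iff.1 f.2 k
    rw [hι] at hfz
    rwa [hfz, coeff_monomial, if_pos rfl] at h1

set_option synthInstance.maxHeartbeats 200000 in
/-- The bound of the Dao number of weakly `m`-full ideals by the regularity. -/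
theorem IsDaoNumber.le_isRegularity {b : R} (hb : b ∈ m) (hb0 : b ≠ 0)
    (hreg : ∀ r, b * r = 0 → r = 0) {n : ℕ} {y : Fin n → reesAlgebra m}
    (hy : IsMinimalGenerators (reesPart m) y) {d : ℕ} (hd : IsDaoNumber IsWeaklyMFull m I d) {r : ℤ}
    (hr0 : 0 ≤ r) (hr : IsRegularity (reesIdealPart m I) y r) : (d : ℤ) ≤ r := by
  have hb1 : b ∈ m ^ 1 := by rwa [pow_one]
  obtain ⟨i, rfl⟩ : ∃ i, n = i + 1 := by
    refine Nat.exists_eq_succ_of_ne_zero ?_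
    rintro rfl
    have hmem := reesMonomial_mem_irrelevantIdeal (m := m) one_pos ⟨b, hb1⟩
    rw [← hy.span_eq, Set.range_eq_empty, Ideal.span_empty, Ideal.mem_bot] at hmem
    have h := congrArg (fun f : reesAlgebra m => (f : R[X]).coeff 1) hmem
    simp only [coe_reesMonomial, coeff_monomial, if_pos] at h
    exact hb0 h
  -- A failure at `k ≥ r` would give a class with `j - i = k + 1 > r`.
  have : d ≤ r.toNat := hd.2 fun k hk => by
    refine le_antisymm (fun z hz => ?_) (le_mul_colon _ _)
    by_contra hzk
    rw [mul_assoc, ← pow_succ, Submodule.mem_colon] at hz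
    have := hr.2 ⟨i, _, rfl, nontrivial_koszulHomology_of_mem_colon hb hreg hy hz hzk⟩
    lia
  lia

end ReesKoszul

/-! ### Common form of the local and the graded case -/

section Reduction

theorem exists_mem_regular_of_ringDepth_pos {R : Type*} [CommRing R] {m : Ideal R}
    (h : 0 < ringDepth m) : ∃ b ∈ m, b ≠ 0 ∧ ∀ r, b * r = 0 → r = 0 := by
  rw [ringDepth] at h
  obtain ⟨rs, h⟩ := lt_iSup_iff.1 h
  obtain ⟨⟨hm, hreg⟩, hlen⟩ := lt_iSup_iff.1 h
  cases rs with
  | nil => simp at hlen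
  | cons b rs =>
    have hb := ((RingTheory.Sequence.isRegular_cons_iff R b rs).1 hreg).1
    have hb' : ∀ r, b * r = 0 → r = 0 := fun r hr => hb (by simpa using hr)
    refine ⟨b, hm b (by simp), ?_, hb'⟩
    rintro rfl
    have : Subsingleton R := subsingleton_of_zero_eq_one (hb' 1 (zero_mul 1)).symm
    exact hreg.top_ne_smul (Subsingleton.elim _ _)

/-- The comparison of the Dao numbers and their bound by the regularity, for a Noetherian ring
whose ideals in question are determined by their localizations at `m`. -/
theorem exists_isDaoNumber_and_le_isRegularity {R : Type*} [CommRing R] [IsNoetherianRing R]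
    {m I : Ideal R} [m.IsMaximal] [Infinite (R ⧸ m)] (hdepth : 0 < ringDepth m)
    (h0 : ∀ s r, s - 1 ∈ m → s * r = 0 → r = 0)
    (hI : ∀ s r, s - 1 ∈ m → s * r ∈ I → r ∈ I) :
    ∃ d₁ d₂ d₃ : ℕ,
      IsDaoNumber IsMFull m I d₁ ∧ IsDaoNumber IsFull m I d₂ ∧
      IsDaoNumber IsWeaklyMFull m I d₃ ∧ d₂ ≤ d₃ ∧ d₃ = d₁ ∧
      (I ≠ ⊥ → ∀ (n : ℕ) (y : Fin n → reesAlgebra m), IsMinimalGenerators (reesPart m) y →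
        ∃ r : ℤ, IsRegularity (reesIdealPart m I) y r ∧ (d₁ : ℤ) ≤ r) := by
  obtain ⟨b, hb, hb0, hreg⟩ := exists_mem_regular_of_ringDepth_pos hdepth
  obtain ⟨d₁, d₂, h₁, h₂, h₃, hle⟩ := exists_isDaoNumber hb hreg h0 hI
  refine ⟨d₁, d₂, d₁, h₁, h₂, h₃, hle, rfl, fun hI0 n y hy => ?_⟩
  obtain ⟨r, hr0, hr⟩ := exists_isRegularity_reesIdealPart hI0 hy
  exact ⟨r, hr, h₃.le_isRegularity hb hb0 hreg hy hr0 hr⟩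

end Reduction

/-! ### The homogeneous maximal ideal and elements congruent to one -/

section Graded

variable {K R : Type*} [Field K] [CommRing R] [Algebra K R] (𝒜 : ℕ → Submodule K R)
  [GradedAlgebra 𝒜]

theorem irrelevant_isMaximal [Nontrivial R] (h0 : 𝒜 0 = 1) :
    (HomogeneousIdeal.irrelevant 𝒜).toIdeal.IsMaximal := by
  have hmem : ∀ a, a ∈ (HomogeneousIdeal.irrelevant 𝒜).toIdeal ↔ GradedRing.proj 𝒜 0 a = 0 :=
    fun a => HomogeneousIdeal.mem_irrelevant_iff 𝒜 a
  refine Ideal.isMaximal_iff.2 ⟨fun h => ?_, fun J x hJ hx hxJ => ?_⟩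
  · rw [hmem, GradedRing.proj_apply, DirectSum.decompose_of_mem_same _ SetLike.GradedOne.one_mem] at h
    exact one_ne_zero h
  · have hx0 : GradedRing.proj 𝒜 0 x ∈ 𝒜 0 := SetLike.coe_mem _
    have hsub : x - GradedRing.proj 𝒜 0 x ∈ J := hJ ((hmem _).2 (by
      rw [map_sub, sub_eq_zero]
      exact (DirectSum.decompose_of_mem_same _ hx0).symm))
    rw [h0] at hx0
    obtain ⟨c, hc⟩ := Submodule.mem_one.1 hx0
    have hc0 : c ≠ 0 := by
      rintro rfl
      exact hx ((hmem x).2 (by rw [← hc, map_zero]))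
    have hcJ : algebraMap K R c ∈ J := by
      rw [hc]
      simpa using sub_mem hxJ hsub
    have := J.mul_mem_left (algebraMap K R c⁻¹) hcJ
    rwa [← map_mul, inv_mul_cancel₀ hc0, map_one] at this

/-- As `s - 1` has no constant term, the component `r_i` is `(s r)_i` minus products involving only
components of `r` of degree below `i`; induct on `i`. -/
theorem Ideal.IsHomogeneous.mem_of_mul_mem {I : Ideal R} (hI : I.IsHomogeneous 𝒜) {s r : R}
    (hs : s - 1 ∈ (HomogeneousIdeal.irrelevant 𝒜).toIdeal) (hsr : s * r ∈ I) : r ∈ I := by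
  classical
  have hs0 : (DirectSum.decompose 𝒜 (s - 1) 0 : R) = 0 :=
    (HomogeneousIdeal.mem_irrelevant_iff 𝒜 _).1 hs
  have key : ∀ i, (DirectSum.decompose 𝒜 r i : R) ∈ I := by
    intro i
    induction i using Nat.strong_induction_on with
    | _ i ih =>
      have hr : r = s * r - (s - 1) * r := by ring
      rw [hr, DirectSum.decompose_sub, DirectSum.sub_apply, AddSubgroupClass.coe_sub]
      refine sub_mem (hI i hsr) ?_
      rw [DirectSum.decompose_mul, DirectSum.coe_mul_apply]
      refine Ideal.sum_mem _ fun p hp => ?_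
      rcases Nat.eq_zero_or_pos p.1 with h | h
      · rw [h, hs0, zero_mul]
        exact zero_mem _
      · exact Ideal.mul_mem_left _ _ (ih _ (by have := (Finset.mem_filter.1 hp).2; lia))
  rw [← DirectSum.sum_support_decompose 𝒜 r]
  exact Ideal.sum_mem _ fun i _ => key i

end Graded
/-- The bound `d₂(I) ≤ d₃(I) = d₁(I) ≤ reg R(m, I)` for regular `R`: first the local case, then the
standard graded case. -/
theorem corollary1p4 :
    (∀ (R : Type*) [CommRing R] [IsLocalRing R] [IsNoetherianRing R]
        [Infinite (IsLocalRing.ResidueField R)] [IsRegularLocalRing R] (m I : Ideal R),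
      m = IsLocalRing.maximalIdeal R → 0 < ringDepth m →
      ∃ d₁ d₂ d₃ : ℕ,
        IsDaoNumber IsMFull m I d₁ ∧ IsDaoNumber IsFull m I d₂ ∧
        IsDaoNumber IsWeaklyMFull m I d₃ ∧
        d₂ ≤ d₃ ∧ d₃ = d₁ ∧
        (I ≠ ⊥ → ∀ (n : ℕ) (y : Fin n → reesAlgebra m), IsMinimalGenerators (reesPart m) y →
          ∃ r : ℤ, IsRegularity (reesIdealPart m I) y r ∧ (d₁ : ℤ) ≤ r)) ∧
    (∀ (K R : Type*) [Field K] [Infinite K] [CommRing R] [IsNoetherianRing R] [Algebra K R]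
        (𝒜 : ℕ → Submodule K R) [GradedAlgebra 𝒜] [IsRegularRing R] (m I : Ideal R),
      𝒜 0 = 1 → Module.Finite K (𝒜 1) → Algebra.adjoin K (𝒜 1 : Set R) = ⊤ →
      m = (HomogeneousIdeal.irrelevant 𝒜).toIdeal → 0 < ringDepth m →
      I.IsHomogeneous 𝒜 →
      ∃ d₁ d₂ d₃ : ℕ,
        IsDaoNumber IsMFull m I d₁ ∧ IsDaoNumber IsFull m I d₂ ∧
        IsDaoNumber IsWeaklyMFull m I d₃ ∧
        d₂ ≤ d₃ ∧ d₃ = d₁ ∧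
        (I ≠ ⊥ → ∀ (n : ℕ) (y : Fin n → reesAlgebra m), IsMinimalGenerators (reesPart m) y →
          ∃ r : ℤ, IsRegularity (reesIdealPart m I) y r ∧ (d₁ : ℤ) ≤ r)) := by
  refine ⟨?_, ?_⟩
  · rintro R _ _ _ _ _ m I rfl hdepth
    have : Infinite (R ⧸ IsLocalRing.maximalIdeal R) := ‹Infinite (IsLocalRing.ResidueField R)›
    have hunit : ∀ s : R, s - 1 ∈ IsLocalRing.maximalIdeal R → IsUnit s := fun s hs => by
      by_contra h
      have := sub_mem ((IsLocalRing.mem_maximalIdeal s).2 h) hs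
      rw [sub_sub_cancel] at this
      exact (Ideal.ne_top_iff_one _).1 Ideal.IsPrime.ne_top' this
    exact exists_isDaoNumber_and_le_isRegularity hdepth
      (fun s r hs h => (hunit s hs).mul_right_eq_zero.1 h)
      (fun s r hs h => (Ideal.unit_mul_mem_iff_mem _ (hunit s hs)).1 h)
  · rintro K R _ _ _ _ _ 𝒜 _ _ m I h𝒜 - - rfl hdepth hI
    obtain ⟨b, -, hb0, -⟩ := exists_mem_regular_of_ringDepth_pos hdepth
    have : Nontrivial R := ⟨b, 0, hb0⟩
    have hmax := irrelevant_isMaximal 𝒜 h𝒜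
    have : Nontrivial (R ⧸ (HomogeneousIdeal.irrelevant 𝒜).toIdeal) :=
      Ideal.Quotient.nontrivial_iff.2 hmax.ne_top
    have : Infinite (R ⧸ (HomogeneousIdeal.irrelevant 𝒜).toIdeal) :=
      Infinite.of_injective _ (algebraMap K _).injective
    refine exists_isDaoNumber_and_le_isRegularity hdepth (fun s r hs h => ?_)
      (fun s r hs h => hI.mem_of_mul_mem 𝒜 hs h)
    exact Ideal.mem_bot.1 ((Ideal.IsHomogeneous.bot 𝒜).mem_of_mul_mem 𝒜 hs (Ideal.mem_bot.2 h))
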